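/- Let $\Lambda$ be a (not necessarily commutative) left and right Noetherian ring. A finitely generated $\Lambda$-module $M$ is called reflexive if the evaluation map $M\to\operatorname{Hom}_{\Lambda^{\mathrm{op}}}(\operatorname{Hom}_\Lambda(M,\Lambda),\Lambda)$ is an isomorphism; $\operatorname{refl}\Lambda$ denotes the full subcategory of finitely generated reflexive modules in the category of $\Lambda$-modules. An additive category is quasi-abelian if every morphism has a kernel and a cokernel, kernels are closed under push-outs, and cokernels are closed under pull-backs. Let $0\to\Lambda\to I^0\to I^1\to\cdots$ be the minimal injective resolution of $\Lambda$ as a $\Lambda$-module. We say that $\Lambda$ satisfies the $(2,2)$-condition if $I^0$ and $I^1$ have flat dimension $<2$, and that $\Lambda$ satisfies the two-sided $(2,2)$-condition if both $\Lambda$ and $\Lambda^{\mathrm{op}}$ satisfy the $(2,2)$-condition. For a $\Lambda$-module $M$, the strong grade of $M$ is the infimum of all $n\ge 0$ such that $\operatorname{Ext}^n_\Lambda(N,\Lambda)\neq0$ for some submodule $N\subseteq M$ (it is $\infty$ if there is no such $n$). Theorem. (1) The category $\operatorname{refl}\Lambda$ is quasi-abelian if and only if $\Lambda$ satisfies the two-sided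 $(2,2)$-condition. (2) The ring $\Lambda$ satisfies the $(2,2)$-condition if and only if, for every finitely generated $\Lambda^{\mathrm{op}}$-module $X$, the $\Lambda$-module $\operatorname{Ext}^2_{\Lambda^{\mathrm{op}}}(X,\Lambda)$ has strong grade at least $2$. The same equivalence holds with $\Lambda^{\mathrm{op}}$ in place of $\Lambda$. -/

import Mathlib

open CategoryTheory CategoryTheory.Limits CategoryTheory.Abelian TensorProduct

universe u v w

/-! Modules over `R` are left `R`-modules; right `R`-modules are modules over `Rᵐᵒᵖ`. -/

/-! ### Quasi-abelian categories -/

section QuasiAbelian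

variable (C : Type w) [Category.{v} C] [Preadditive C]

/-- The morphisms of `C` that are a kernel of some morphism. -/
def kernelMorphisms : MorphismProperty C := fun _ _ f => Nonempty (NormalMono f)

/-- The morphisms of `C` that are a cokernel of some morphism. -/
def cokernelMorphisms : MorphismProperty C := fun _ _ f => Nonempty (NormalEpi f)

/-- A quasi-abelian category: an additive category with kernels and cokernels, in which kernels
are closed under push-outs and cokernels are closed under pull-backs. -/
structure IsQuasiAbelian : Prop where
  hasFiniteBiproducts : HasFiniteBiproducts C
  hasKernels : HasKernels C
  hasCokernels : HasCokernels C
  kernels_pushout : (kernelMorphisms C).IsStableUnderCobaseChange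
  cokernels_pullback : (cokernelMorphisms C).IsStableUnderBaseChange

end QuasiAbelian

/-! ### Reflexive modules -/

section Reflexive

variable (R : Type u) [Ring R] (M : Type v) [AddCommGroup M] [Module R M]

/-- The evaluation map `M → Hom_{Rᵐᵒᵖ}(Hom_R(M, R), R)`, `m ↦ (f ↦ f m)`. Here `Hom_R(M, R)` is
a right `R`-module through the right multiplication of `R`, and the double dual is a left
`R`-module through the left multiplication of `R`. -/
def bidualEval : M →ₗ[R] ((M →ₗ[R] R) →ₗ[Rᵐᵒᵖ] R) where
  toFun m :=
    { toFun := fun f => f m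
      map_add' := fun _ _ => rfl
      map_smul' := fun _ _ => rfl }
  map_add' x y := by ext f; exact map_add f x y
  map_smul' r x := by ext f; exact map_smul f r x

/-- The finitely generated reflexive `R`-modules, as a property of objects of `ModuleCat R`. -/
def reflexiveModules : ObjectProperty (ModuleCat.{u} R) :=
  fun M => Module.Finite R M ∧ Function.Bijective (bidualEval R M)

/-- The category `refl R` of finitely generated reflexive `R`-modules, a full subcategory of the
category of `R`-modules. -/
abbrev ReflCat : Type (u + 1) := (reflexiveModules R).FullSubcategory

end Reflexive

/-! ### Flat dimension over a noncommutative ring -/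

section Flat

variable (R : Type u) [Ring R]

/-- The relations `x r ⊗ m = x ⊗ r m` in `X ⊗_ℤ M`. -/
def balancedRelations (X : Type u) [AddCommGroup X] [Module Rᵐᵒᵖ X]
    (M : Type u) [AddCommGroup M] [Module R M] : AddSubgroup (X ⊗[ℤ] M) :=
  AddSubgroup.closure {t | ∃ (x : X) (r : R) (m : M),
    t = (MulOpposite.op r • x) ⊗ₜ[ℤ] m - x ⊗ₜ[ℤ] (r • m)}

/-- The tensor product `X ⊗_R M` of a right module `X` and a left module `M`, an abelian group. -/
abbrev BalancedTensor (X : Type u) [AddCommGroup X] [Module Rᵐᵒᵖ X]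
    (M : Type u) [AddCommGroup M] [Module R M] : Type u :=
  (X ⊗[ℤ] M) ⧸ balancedRelations R X M

/-- The map `f ⊗ id : X ⊗_R M → Y ⊗_R M` induced by a map `f : X → Y` of right modules. -/
def BalancedTensor.map {X Y : Type u} [AddCommGroup X] [Module Rᵐᵒᵖ X] [AddCommGroup Y]
    [Module Rᵐᵒᵖ Y] (M : Type u) [AddCommGroup M] [Module R M] (f : X →ₗ[Rᵐᵒᵖ] Y) :
    BalancedTensor R X M →+ BalancedTensor R Y M :=
  QuotientAddGroup.map _ _
    (LinearMap.rTensor M f.toAddMonoidHom.toIntLinearMap).toAddMonoidHom (by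
      rw [balancedRelations, AddSubgroup.closure_le]
      rintro _ ⟨x, r, m, rfl⟩
      refine AddSubgroup.subset_closure ⟨f x, r, m, ?_⟩
      simp [LinearMap.rTensor_tmul])

/-- A left `R`-module `M` is flat if `- ⊗_R M` preserves injections of right modules. -/
def IsFlatModule (M : Type u) [AddCommGroup M] [Module R M] : Prop :=
  ∀ (X Y : ModuleCat.{u} Rᵐᵒᵖ) (f : X →ₗ[Rᵐᵒᵖ] Y), Function.Injective f →
    Function.Injective (BalancedTensor.map R M f)

/-- `HasFlatDimensionLT R n M`: the flat dimension of `M` is `< n`, that is, there is an exact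
sequence `0 → F_{n-1} → ⋯ → F_0 → M → 0` with all `F_i` flat (and `M = 0` if `n = 0`). -/
def HasFlatDimensionLT : ℕ → ModuleCat.{u} R → Prop
  | 0, M => Subsingleton M
  | n + 1, M => ∃ (F : ModuleCat.{u} R) (p : F →ₗ[R] M), IsFlatModule R F ∧
      Function.Surjective p ∧ HasFlatDimensionLT n (ModuleCat.of R (LinearMap.ker p))

end Flat

/-! ### The `(l, n)`-condition -/

section AuslanderCondition

variable (R : Type u) [Ring R]

/-- An injective resolution `I` of a module is minimal if every cocycle submodule
`Ker (I^n → I^{n+1})` is essential in `I^n`, i.e. meets each nonzero submodule of `I^n`. (Thus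
`I^0` is an injective hull of the module, and `I^{n+1}` one of the image of `I^n`.) -/
def IsMinimalInjectiveResolution {M : ModuleCat.{u} R} (I : InjectiveResolution M) : Prop :=
  ∀ (n : ℕ) (N : Submodule R (I.cocomplex.X n)),
    N ⊓ LinearMap.ker (I.cocomplex.d n (n + 1)).hom = ⊥ → N = ⊥

/-- The `(l, n)`-condition: the first `n` terms of the minimal injective resolution of the left
module `R` have flat dimension `< l`. -/
def AuslanderCondition (l n : ℕ) : Prop :=
  ∃ I : InjectiveResolution (ModuleCat.of R R), IsMinimalInjectiveResolution R I ∧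
    ∀ i < n, HasFlatDimensionLT R l (I.cocomplex.X i)

/-- The two-sided `(l, n)`-condition: the `(l, n)`-condition for `R` and for `Rᵐᵒᵖ`. -/
def TwoSidedAuslanderCondition (l n : ℕ) : Prop :=
  AuslanderCondition R l n ∧ AuslanderCondition Rᵐᵒᵖ l n

end AuslanderCondition

/-! ### Strong grade -/

section Grade

variable (R : Type u) [Ring R]

/-- The grade of a left module `M`: the least `n` with `Ext^n_R(M, R) ≠ 0` (`⊤` if none). -/
noncomputable def moduleGrade (M : Type u) [AddCommGroup M] [Module R M] : ℕ∞ :=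
  sInf {k : ℕ∞ | ∃ n : ℕ, k = n ∧ Nontrivial (Ext (ModuleCat.of R M) (ModuleCat.of R R) n)}

/-- The strong grade of a left module `M`: the least `n` such that `Ext^n_R(N, R) ≠ 0` for some
submodule `N` of `M` (`⊤` if none). -/
noncomputable def strongGrade (M : Type u) [AddCommGroup M] [Module R M] : ℕ∞ :=
  ⨅ N : Submodule R M, moduleGrade R N

/-- Left multiplication by `r`, as an endomorphism of the right module `R`. -/
def leftMulEnd (r : R) : ModuleCat.of Rᵐᵒᵖ R ⟶ ModuleCat.of Rᵐᵒᵖ R :=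
  ModuleCat.ofHom
    { toFun := fun x => r * x
      map_add' := fun x y => mul_add r x y
      map_smul' := fun a x => (mul_assoc r x a.unop).symm }

/-- `Ext^n_{Rᵐᵒᵖ}(X, R)` for a right module `X`. -/
abbrev ExtDual (X : ModuleCat.{u} Rᵐᵒᵖ) (n : ℕ) : Type u :=
  Ext X (ModuleCat.of Rᵐᵒᵖ R) n

/-- The left `R`-module structure on `Ext^n_{Rᵐᵒᵖ}(X, R)`, functorially induced by the left
multiplication of `R` on the coefficients. -/
noncomputable instance ExtDual.module (X : ModuleCat.{u} Rᵐᵒᵖ) (n : ℕ) :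
    Module R (ExtDual R X n) where
  smul r e := e.comp (Ext.mk₀ (leftMulEnd R r)) (add_zero n)
  one_smul e := by
    change e.comp (Ext.mk₀ (leftMulEnd R 1)) (add_zero n) = e
    have h : leftMulEnd R 1 = 𝟙 _ := by ext; exact one_mul _
    rw [h, Ext.comp_mk₀_id]
  mul_smul r s e := by
    change e.comp (Ext.mk₀ (leftMulEnd R (r * s))) (add_zero n) =
      (e.comp (Ext.mk₀ (leftMulEnd R s)) (add_zero n)).comp
        (Ext.mk₀ (leftMulEnd R r)) (add_zero n)
    have h : leftMulEnd R (r * s) = leftMulEnd R s ≫ leftMulEnd R r := by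
      ext; exact mul_assoc r s _
    rw [h, ← Ext.mk₀_comp_mk₀, Ext.comp_assoc_of_third_deg_zero]
  smul_zero r := Ext.zero_comp X n (Ext.mk₀ (leftMulEnd R r)) n (add_zero n)
  smul_add r e f := Ext.add_comp _ _ _ _
  add_smul r s e := by
    change e.comp (Ext.mk₀ (leftMulEnd R (r + s))) (add_zero n) =
      e.comp (Ext.mk₀ (leftMulEnd R r)) (add_zero n) +
        e.comp (Ext.mk₀ (leftMulEnd R s)) (add_zero n)
    have h : leftMulEnd R (r + s) = leftMulEnd R r + leftMulEnd R s := by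
      ext; exact add_mul r s _
    rw [h, Ext.mk₀_add, Ext.comp_add]
  zero_smul e := by
    change e.comp (Ext.mk₀ (leftMulEnd R 0)) (add_zero n) = 0
    have h : leftMulEnd R 0 = 0 := by ext; exact zero_mul _
    rw [h, Ext.mk₀_zero, Ext.comp_zero]

/-- The strong grade form of the `(l, n)`-condition: the left module `Ext^l_{Rᵐᵒᵖ}(X, R)` has
strong grade at least `n` for every finitely generated right module `X`. -/
def StrongGradeCondition (l n : ℕ) : Prop :=
  ∀ X : ModuleCat.{u} Rᵐᵒᵖ, Module.Finite Rᵐᵒᵖ X → (n : ℕ∞) ≤ strongGrade R (ExtDual R X l)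

end Grade

/-! Both parts pass through the left modules `E = Ext²(X, R)`, with `X` a finitely generated right
module.

Part (2). Let `I` be an injective left module. Its flat dimension is at most one iff `Ext²(X, I⁺) =
0` for all finitely generated `X`, where `I⁺` is the character module
(`hasFlatDimensionLT_two_iff`). For a finite free presentation of `X` with first map `d`, this says
that every map `Ker d → I⁺` extends to the free module. Since `Ext²(X, R)` is `Hom(Ker d, R)` modulo
the maps that extend, injectivity of `I` converts the extension property into `Hom(Ext²(X, R), I) =
0`; behind this is the isomorphism `Tor₂(X, I) ≅ Hom(Ext²(X, R), I)`. If `I⁰`, `I¹` begin a minimal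
injective resolution of `R`, then `Hom(E, I⁰) = Hom(E, I¹) = 0` iff `Hom(N, R) = Ext¹(N, R) = 0` for
all submodules `N` of `E`, that is, iff `E` has strong grade at least two
(`forall_submodule_subsingleton_ext_iff`).

Part (1). If `M` is the Auslander transpose of `X`, then `Ext²(X, R)` is the cokernel of `M → M**`
(`exists_bidual_to_extDual`). The strong grade condition therefore says that, for every map `F →
M**`, functionals on the preimage of the image of `M` extend uniquely to `F`: the preimage is dual
dense. In `refl R` the cokernels are exactly the morphisms with dual dense image
(`ReflCat.cokernelMorphisms_iff`), and the image of a pulled-back morphism is the preimage of the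
original image. Hence the strong grade condition makes cokernels stable under pull-back, and it also
provides cokernels, as biduals of module cokernels. Conversely, `M → M**` occurs inside a cokernel
of free modules, and pulling it back along maps from free modules returns the strong grade
condition. The duality `M ↦ M*` between `refl R` and `refl Rᵐᵒᵖ` turns statements about kernels into
statements about cokernels over `Rᵐᵒᵖ`. -/

/-! ### Injective modules and minimal injective resolutions -/

section InjectiveHull

/-- A map into a Baer module extends along any map with smaller kernel. -/
theorem Module.Baer.exists_comp_eq_of_ker_le {R : Type*} [Ring R] {Q M N : Type*}
    [AddCommGroup Q] [Module R Q] [AddCommGroup M] [Module R M] [AddCommGroup N] [Module R N]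
    (hQ : Module.Baer R Q) (f : M →ₗ[R] N) (g : M →ₗ[R] Q)
    (h : LinearMap.ker f ≤ LinearMap.ker g) : ∃ k : N →ₗ[R] Q, k ∘ₗ f = g := by
  obtain ⟨k, hk⟩ := hQ.extension_property ((LinearMap.ker f).liftQ f le_rfl)
    (LinearMap.ker_eq_bot.1 (Submodule.ker_liftQ_eq_bot _ _ _ le_rfl))
    ((LinearMap.ker f).liftQ g h)
  refine ⟨k, LinearMap.ext fun x => ?_⟩
  simpa using LinearMap.congr_fun hk (Submodule.Quotient.mk x)

theorem Module.Injective.exists_comp_eq_of_ker_le {R : Type u} [Ring R] {Q : Type u}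
    {M N : Type*} [AddCommGroup Q] [Module R Q] [Module.Injective R Q]
    [AddCommGroup M] [Module R M] [AddCommGroup N] [Module R N]
    (f : M →ₗ[R] N) (g : M →ₗ[R] Q)
    (h : LinearMap.ker f ≤ LinearMap.ker g) : ∃ k : N →ₗ[R] Q, k ∘ₗ f = g :=
  (Module.Baer.of_injective inferInstance).exists_comp_eq_of_ker_le f g h

/-- A retract of an injective module is injective. -/
theorem Module.Injective.of_retract {R : Type u} [Ring R] {Q P : Type v}
    [AddCommGroup Q] [Module R Q] [AddCommGroup P] [Module R P] (hQ : Module.Injective R Q)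
    (i : P →ₗ[R] Q) (r : Q →ₗ[R] P) (hr : ∀ x, r (i x) = x) : Module.Injective R P where
  out X Y _ _ _ _ f hf g := by
    obtain ⟨h, hh⟩ := hQ.out f hf (i ∘ₗ g)
    exact ⟨r ∘ₗ h, fun x => by simp [hh, hr]⟩

variable {R : Type u} [Ring R]

/-- `H` contains no nonzero submodule meeting `M` trivially. -/
def IsEssentialIn {Q : Type v} [AddCommGroup Q] [Module R Q] (M H : Submodule R Q) : Prop :=
  ∀ N ≤ H, N ⊓ M = ⊥ → N = ⊥

/-- Essentiality passes to unions of chains because it can be tested on cyclic submodules, and each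
element of the union already lies in one member of the chain. -/
theorem exists_maximal_essential {Q : Type v} [AddCommGroup Q] [Module R Q]
    (M : Submodule R Q) : ∃ H, Maximal (fun H => M ≤ H ∧ IsEssentialIn M H) H := by
  obtain ⟨H, -, hH⟩ := zorn_le_nonempty₀ {H : Submodule R Q | M ≤ H ∧ IsEssentialIn M H}
    (fun c hc hchain y hy => by
      refine ⟨sSup c, ⟨(hc hy).1.trans (le_sSup hy), fun N hN hNM => ?_⟩, fun z => le_sSup⟩
      refine (Submodule.eq_bot_iff _).2 fun x hx => ?_
      obtain ⟨H, hHc, hxH⟩ := (Submodule.mem_sSup_of_directed ⟨y, hy⟩ hchain.directedOn).1 (hN hx)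
      have hspan : Submodule.span R {x} ≤ N := by simpa using hx
      have h := (hc hHc).2 (Submodule.span R {x}) (by simpa using hxH)
        (le_bot_iff.1 ((inf_le_inf_right M hspan).trans hNM.le))
      simpa using h) M ⟨le_rfl, fun N hN hNM => by rwa [inf_eq_left.2 hN] at hNM⟩
  exact ⟨H, hH⟩

theorem exists_maximal_disjoint {Q : Type v} [AddCommGroup Q] [Module R Q]
    (H : Submodule R Q) : ∃ C, Maximal (fun C => C ⊓ H = ⊥) C := by
  obtain ⟨C, -, hC⟩ := zorn_le_nonempty₀ {C : Submodule R Q | C ⊓ H = ⊥}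
    (fun c hc hchain y hy => by
      refine ⟨sSup c, (Submodule.eq_bot_iff _).2 fun x hx => ?_, fun z => le_sSup⟩
      obtain ⟨C, hCc, hxC⟩ := (Submodule.mem_sSup_of_directed ⟨y, hy⟩ hchain.directedOn).1 hx.1
      exact (Submodule.eq_bot_iff _).1 (hc hCc) x ⟨hxC, hx.2⟩) ⊥ (bot_inf_eq H)
  exact ⟨C, hC⟩

/-- A maximal essential extension inside an injective module is injective. -/
theorem Module.Injective.of_maximal_essential {Q : Type u} [AddCommGroup Q] [Module R Q]
    (hQ : Module.Injective R Q) (M H : Submodule R Q)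
    (hH : Maximal (fun H => M ≤ H ∧ IsEssentialIn M H) H) : Module.Injective R H := by
  obtain ⟨C, hC⟩ := exists_maximal_disjoint H
  -- `H` embeds in `Q ⧸ C`, so injectivity of `Q` extends the inclusion of `H` to a map `g` on `Q ⧸
  -- C`. The aim is that `g` has image `H`, which makes `H` a retract of `Q`.
  have hker : LinearMap.ker (C.mkQ ∘ₗ H.subtype) ≤ LinearMap.ker H.subtype := fun x hx => by
    have hx' : (x : Q) ∈ C := by simpa using hx
    exact (Submodule.eq_bot_iff _).1 hC.prop x ⟨hx', x.2⟩
  obtain ⟨g, hg⟩ := Module.Injective.exists_comp_eq_of_ker_le (C.mkQ ∘ₗ H.subtype) H.subtype hker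
  have hgH : ∀ x ∈ H, g (C.mkQ x) = x := fun x hx => LinearMap.congr_fun hg ⟨x, hx⟩
  -- Maximality of `C` makes the image of `H` essential in `Q ⧸ C`; hence `g` is injective, being so
  -- on `H`.
  have hess : ∀ N : Submodule R (Q ⧸ C), (∀ x ∈ H, C.mkQ x ∈ N → x = 0) → N = ⊥ := by
    intro N hN
    have hle : C ≤ N.comap C.mkQ := fun x hx => by simp [(Submodule.Quotient.mk_eq_zero C).2 hx]
    have h1 : N.comap C.mkQ ≤ C := hC.le_of_ge
      ((Submodule.eq_bot_iff _).2 fun x hx => hN x hx.2 hx.1) hle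
    refine (Submodule.eq_bot_iff _).2 fun y hy => ?_
    obtain ⟨x, rfl⟩ := C.mkQ_surjective y
    exact (Submodule.Quotient.mk_eq_zero C).2 (h1 hy)
  have hgker : LinearMap.ker g = ⊥ := hess _ fun x hx hgx => by
    rw [LinearMap.mem_ker, hgH x hx] at hgx; exact hgx
  have hHle : H ≤ LinearMap.range g := fun x hx => ⟨C.mkQ x, hgH x hx⟩
  -- The image of `g` is an essential extension of `H`, hence of `M`, so maximality of `H` leaves no
  -- room for it to be larger.
  have hrange : LinearMap.range g ≤ H := by
    refine hH.le_of_ge ⟨hH.prop.1.trans hHle, fun N hN hNM => ?_⟩ hHle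
    have hNH : N ⊓ H = ⊥ := hH.prop.2 _ inf_le_right
      (le_bot_iff.1 (by rw [← hNM]; exact inf_le_inf_right M inf_le_left))
    have hcomap : N.comap g = ⊥ := hess _ fun x hx hxN => by
      rw [Submodule.mem_comap, hgH x hx] at hxN
      exact (Submodule.eq_bot_iff _).1 hNH x ⟨hxN, hx⟩
    refine (Submodule.eq_bot_iff _).2 fun x hx => ?_
    obtain ⟨y, rfl⟩ := hN hx
    have : y ∈ N.comap g := hx
    rw [hcomap, Submodule.mem_bot] at this
    rw [this, map_zero]
  exact hQ.of_retract H.subtype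
    (LinearMap.codRestrict H (g ∘ₗ C.mkQ) fun x => hrange ⟨C.mkQ x, rfl⟩)
    fun x => Subtype.ext (hgH x x.2)

/-- Every module has an injective hull. -/
theorem exists_injective_hull (M : ModuleCat.{u} R) :
    ∃ (E : ModuleCat.{u} R) (i : M →ₗ[R] E), Function.Injective i ∧ Module.Injective R E ∧
      ∀ N : Submodule R E, N ⊓ LinearMap.range i = ⊥ → N = ⊥ := by
  let Q := CategoryTheory.Injective.under M
  let j : M →ₗ[R] Q := (CategoryTheory.Injective.ι M).hom
  have hj : Function.Injective j := (ModuleCat.mono_iff_injective _).1 inferInstance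
  have hQ : Module.Injective R Q := by
    have : CategoryTheory.Injective (ModuleCat.of R Q) :=
      CategoryTheory.Injective.injective_under M
    exact Module.injective_module_of_injective_object R Q
  obtain ⟨H, hH⟩ := exists_maximal_essential (LinearMap.range j)
  refine ⟨ModuleCat.of R H, j.codRestrict H fun x => hH.prop.1 ⟨x, rfl⟩,
    fun x y hxy => hj (congrArg Subtype.val hxy), hQ.of_maximal_essential _ _ hH, fun N hN => ?_⟩
  have h := hH.prop.2 (N.map H.subtype) (Submodule.map_subtype_le _ _) (by
    refine (Submodule.eq_bot_iff _).2 ?_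
    rintro _ ⟨⟨y, hy, rfl⟩, m, hm⟩
    have : y ∈ N ⊓ LinearMap.range (j.codRestrict H fun x => hH.prop.1 ⟨x, rfl⟩) :=
      ⟨hy, m, Subtype.ext hm⟩
    rw [hN, Submodule.mem_bot] at this
    rw [this, map_zero])
  exact Submodule.map_injective_of_injective (f := H.subtype) Subtype.val_injective
    (h.trans (Submodule.map_bot _).symm)

end InjectiveHull

/-! ### Construction of the minimal injective resolution by iterated injective hulls. -/

section MinimalResolution

variable (R : Type u) [Ring R]

/-- A chosen injective hull. -/
noncomputable def injHull (M : ModuleCat.{u} R) : ModuleCat.{u} R :=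
  (exists_injective_hull M).choose

/-- The embedding of a module into its injective hull. -/
noncomputable def injHullι (M : ModuleCat.{u} R) : M →ₗ[R] injHull R M :=
  (exists_injective_hull M).choose_spec.choose

variable (M : ModuleCat.{u} R)

theorem injHullι_injective : Function.Injective (injHullι R M) :=
  (exists_injective_hull M).choose_spec.choose_spec.1

instance injHull_injective : Module.Injective R (injHull R M) :=
  (exists_injective_hull M).choose_spec.choose_spec.2.1

theorem injHull_essential (N : Submodule R (injHull R M))
    (h : N ⊓ LinearMap.range (injHullι R M) = ⊥) : N = ⊥ :=
  (exists_injective_hull M).choose_spec.choose_spec.2.2 N h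

/-- The cosyzygies in the minimal injective resolution. -/
noncomputable def minCosyzygy : ℕ → ModuleCat.{u} R
  | 0 => M
  | n + 1 => ModuleCat.of R
      (injHull R (minCosyzygy n) ⧸ LinearMap.range (injHullι R (minCosyzygy n)))

/-- The projection of an injective hull onto the next cosyzygy. -/
noncomputable def minCosyzygyπ (n : ℕ) :
    injHull R (minCosyzygy R M n) →ₗ[R] minCosyzygy R M (n + 1) :=
  (LinearMap.range (injHullι R (minCosyzygy R M n))).mkQ

theorem minCosyzygyπ_surjective (n : ℕ) : Function.Surjective (minCosyzygyπ R M n) :=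
  Submodule.mkQ_surjective _

theorem ker_minCosyzygyπ (n : ℕ) : LinearMap.ker (minCosyzygyπ R M n) =
    LinearMap.range (injHullι R (minCosyzygy R M n)) :=
  Submodule.ker_mkQ _

/-- The differential of the minimal injective resolution. -/
noncomputable def minDiff (n : ℕ) :
    injHull R (minCosyzygy R M n) →ₗ[R] injHull R (minCosyzygy R M (n + 1)) :=
  injHullι R (minCosyzygy R M (n + 1)) ∘ₗ minCosyzygyπ R M n

theorem ker_minDiff (n : ℕ) : LinearMap.ker (minDiff R M n) =
    LinearMap.range (injHullι R (minCosyzygy R M n)) := by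
  rw [minDiff, LinearMap.ker_comp_of_ker_eq_bot _
    (LinearMap.ker_eq_bot.2 (injHullι_injective R _)), ker_minCosyzygyπ]

theorem range_minDiff (n : ℕ) : LinearMap.range (minDiff R M n) =
    LinearMap.range (injHullι R (minCosyzygy R M (n + 1))) := by
  rw [minDiff, LinearMap.range_comp_of_range_eq_top _
    (LinearMap.range_eq_top.2 (minCosyzygyπ_surjective R M n))]

theorem minDiff_comp_minDiff (n : ℕ) : minDiff R M (n + 1) ∘ₗ minDiff R M n = 0 :=
  LinearMap.range_le_ker_iff.1 ((range_minDiff R M n).trans (ker_minDiff R M (n + 1)).symm).le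

/-- The augmentation of the minimal injective resolution. -/
noncomputable def minAug : M →ₗ[R] injHull R (minCosyzygy R M 0) :=
  injHullι R (minCosyzygy R M 0)

theorem minAug_injective : Function.Injective (minAug R M) :=
  injHullι_injective R (minCosyzygy R M 0)

theorem range_minAug : LinearMap.range (minAug R M) = LinearMap.ker (minDiff R M 0) :=
  (ker_minDiff R M 0).symm

/-- The complex of the minimal injective resolution. -/
noncomputable def minComplex : CochainComplex (ModuleCat.{u} R) ℕ :=
  CochainComplex.of (fun n => injHull R (minCosyzygy R M n))
    (fun n => ModuleCat.ofHom (minDiff R M n))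
    (fun n => ModuleCat.hom_ext (minDiff_comp_minDiff R M n))

theorem minComplex_d (n : ℕ) :
    (minComplex R M).d n (n + 1) = ModuleCat.ofHom (minDiff R M n) :=
  CochainComplex.of_d (fun n => injHull R (minCosyzygy R M n))
    (fun n => ModuleCat.ofHom (minDiff R M n)) n

instance minComplex_injective (n : ℕ) : CategoryTheory.Injective ((minComplex R M).X n) :=
  Module.injective_object_of_injective_module R (injHull R (minCosyzygy R M n))

theorem minComplex_exactAt (n : ℕ) : (minComplex R M).ExactAt (n + 1) := by
  rw [HomologicalComplex.exactAt_iff' _ n (n + 1) (n + 1 + 1) (by simp) (by simp),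
    ShortComplex.moduleCat_exact_iff_range_eq_ker]
  change LinearMap.range ((minComplex R M).d n (n + 1)).hom =
    LinearMap.ker ((minComplex R M).d (n + 1) (n + 1 + 1)).hom
  rw [minComplex_d, minComplex_d]
  exact (range_minDiff R M n).trans (ker_minDiff R M (n + 1)).symm

theorem minAug_comp_d :
    (ModuleCat.ofHom (minAug R M) : M ⟶ (minComplex R M).X 0) ≫ (minComplex R M).d 0 1 = 0 := by
  rw [minComplex_d]
  exact ModuleCat.hom_ext (LinearMap.range_le_ker_iff.1 (range_minAug R M).le)

theorem minAug_exact_and_mono :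
    (ShortComplex.mk _ _ (minAug_comp_d R M)).Exact ∧
      Mono (ModuleCat.ofHom (minAug R M) : M ⟶ (minComplex R M).X 0) := by
  refine ⟨?_, (ModuleCat.mono_iff_injective _).2 (minAug_injective R M)⟩
  rw [ShortComplex.moduleCat_exact_iff_range_eq_ker]
  change LinearMap.range (minAug R M) = LinearMap.ker ((minComplex R M).d 0 1).hom
  rw [minComplex_d]
  exact range_minAug R M

/-- The minimal injective resolution of a module. -/
noncomputable def minResolution : InjectiveResolution M where
  cocomplex := minComplex R M
  ι := (CochainComplex.fromSingle₀Equiv _ _).symm ⟨ModuleCat.ofHom (minAug R M), minAug_comp_d R M⟩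
  quasiIso := ⟨fun n => by
    cases n
    -- In degree zero a quasi-isomorphism from a single object amounts to exactness of `0 → M → I⁰ →
    -- I¹`.
    · rw [CochainComplex.quasiIsoAt₀_iff, ShortComplex.quasiIso_iff_of_zeros]
      · refine (ShortComplex.exact_and_mono_f_iff_of_iso ?_).2 (minAug_exact_and_mono R M)
        refine ShortComplex.isoMk (Iso.refl _) (Iso.refl _) (Iso.refl _) ?_ ?_
        · have h := CochainComplex.fromSingle₀Equiv_symm_apply_f_zero (C := minComplex R M)
            (ModuleCat.ofHom (minAug R M)) (minAug_comp_d R M)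
          exact (Category.id_comp _).trans (h.symm.trans (Category.comp_id _).symm)
        · exact (Category.id_comp _).trans (Category.comp_id _).symm
      all_goals rfl
    · rw [quasiIsoAt_iff_exactAt]
      · apply minComplex_exactAt
      · apply CochainComplex.exactAt_succ_single_obj⟩

theorem minResolution_isMinimal : IsMinimalInjectiveResolution R (minResolution R M) := by
  intro n N hN
  have : (minResolution R M).cocomplex.d n (n + 1) = ModuleCat.ofHom (minDiff R M n) :=
    minComplex_d R M n
  rw [this] at hN
  exact injHull_essential R (minCosyzygy R M n) N (by rw [← ker_minDiff]; exact hN)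

end MinimalResolution
/-! ### `Ext` of modules through short exact sequences -/

section ExtModule

variable {R : Type u} [Ring R]

section ShortExact

variable {A B C W : Type u} [AddCommGroup A] [Module R A] [AddCommGroup B] [Module R B]
  [AddCommGroup C] [Module R C] [AddCommGroup W] [Module R W]

/-- `Ext^0` is `Hom`. -/
theorem subsingleton_ext_zero_iff :
    Subsingleton (Ext (ModuleCat.of R A) (ModuleCat.of R W) 0) ↔ ∀ f : A →ₗ[R] W, f = 0 := by
  rw [Ext.addEquiv₀.toEquiv.subsingleton_congr]
  constructor
  · intro h f
    exact congrArg ModuleCat.Hom.hom (Subsingleton.elim (ModuleCat.ofHom f) 0)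
  · intro h
    exact ⟨fun a b => ModuleCat.hom_ext ((h a.hom).trans (h b.hom).symm)⟩

variable {f : A →ₗ[R] B} {g : B →ₗ[R] C}

/-- The short exact sequence given by an injection and a surjection. -/
abbrev linearShortComplex (h : Function.Exact f g) : ShortComplex (ModuleCat.{u} R) :=
  ModuleCat.shortComplexOfCompEqZero f g h.linearMap_comp_eq_zero

theorem linearShortComplex_shortExact (hf : Function.Injective f) (h : Function.Exact f g)
    (hg : Function.Surjective g) : (linearShortComplex h).ShortExact :=
  ModuleCat.shortComplex_shortExact _ h hf hg

variable (hf : Function.Injective f) (h : Function.Exact f g) (hg : Function.Surjective g)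

/-- The connecting map `Hom(A, W) → Ext^1(C, W)`. -/
noncomputable def extConnecting (a : A →ₗ[R] W) : Ext (ModuleCat.of R C) (ModuleCat.of R W) 1 :=
  (linearShortComplex_shortExact hf h hg).extClass.comp (Ext.mk₀ (ModuleCat.ofHom a)) (add_zero 1)

theorem extConnecting_add (a b : A →ₗ[R] W) :
    extConnecting hf h hg (a + b) = extConnecting hf h hg a + extConnecting hf h hg b := by
  rw [extConnecting, ModuleCat.ofHom_add, Ext.mk₀_add, Ext.comp_add]; rfl

theorem extConnecting_comp {W' : Type u} [AddCommGroup W'] [Module R W'] (a : A →ₗ[R] W)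
    (φ : W →ₗ[R] W') : extConnecting hf h hg (φ ∘ₗ a) =
      (extConnecting hf h hg a).comp (Ext.mk₀ (ModuleCat.ofHom φ)) (add_zero 1) := by
  rw [extConnecting, extConnecting, ModuleCat.ofHom_comp, ← Ext.mk₀_comp_mk₀,
    Ext.comp_assoc_of_third_deg_zero]

theorem extConnecting_eq_zero_iff (a : A →ₗ[R] W) :
    extConnecting hf h hg a = 0 ↔ ∃ b : B →ₗ[R] W, b ∘ₗ f = a := by
  constructor
  · intro h0
    obtain ⟨x, hx⟩ := Ext.contravariant_sequence_exact₁ (linearShortComplex_shortExact hf h hg)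
      (ModuleCat.of R W) (Ext.mk₀ (ModuleCat.ofHom a)) (add_zero 1) h0
    obtain ⟨b, rfl⟩ := (Ext.mk₀_bijective _ _).2 x
    rw [Ext.mk₀_comp_mk₀] at hx
    exact ⟨b.hom, congrArg ModuleCat.Hom.hom ((Ext.mk₀_bijective _ _).1 hx)⟩
  · rintro ⟨b, rfl⟩
    rw [extConnecting, ModuleCat.ofHom_comp, ← Ext.mk₀_comp_mk₀]
    exact (linearShortComplex_shortExact hf h hg).extClass_comp_assoc
      (Ext.mk₀ (ModuleCat.ofHom b))

theorem extConnecting_surjective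
    (hB : Subsingleton (Ext (ModuleCat.of R B) (ModuleCat.of R W) 1)) :
    Function.Surjective (extConnecting (W := W) hf h hg) := by
  intro x
  obtain ⟨y, hy⟩ := Ext.contravariant_sequence_exact₃ (linearShortComplex_shortExact hf h hg)
      (ModuleCat.of R W) x (Subsingleton.elim _ _) (add_zero 1)
  obtain ⟨b, rfl⟩ := (Ext.mk₀_bijective _ _).2 y
  exact ⟨b.hom, hy⟩

theorem subsingleton_ext_of_projective [Module.Projective R B] (n : ℕ) :
    Subsingleton (Ext (ModuleCat.of R B) (ModuleCat.of R W) (n + 1)) :=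
  Ext.subsingleton_of_projective _ _ _

theorem subsingleton_ext_of_injective [Module.Injective R W] (n : ℕ) :
    Subsingleton (Ext (ModuleCat.of R B) (ModuleCat.of R W) (n + 1)) := by
  have : CategoryTheory.Injective (ModuleCat.of R W) :=
    Module.injective_object_of_injective_module R W
  exact Ext.subsingleton_of_injective _ _ _

include hf h hg in
/-- If `Ext^0(C, W) = Ext^1(C, W) = 0`, then maps `A → W` extend uniquely to `B`. -/
theorem comp_bijective_of_subsingleton_ext
    (h0 : Subsingleton (Ext (ModuleCat.of R C) (ModuleCat.of R W) 0))
    (h1 : Subsingleton (Ext (ModuleCat.of R C) (ModuleCat.of R W) 1)) :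
    Function.Bijective (fun b : B →ₗ[R] W => b ∘ₗ f) := by
  rw [subsingleton_ext_zero_iff] at h0
  constructor
  · intro b b' hbb
    have hker : LinearMap.ker g ≤ LinearMap.ker (b - b') := fun x hx => by
      obtain ⟨a, rfl⟩ := (h x).1 hx
      simpa [sub_eq_zero] using LinearMap.congr_fun hbb a
    have hc := h0 ((LinearMap.ker g).liftQ (b - b') hker ∘ₗ
      (g.quotKerEquivOfSurjective hg).symm.toLinearMap)
    refine sub_eq_zero.1 (LinearMap.ext fun x => ?_)
    have hx := LinearMap.congr_fun hc (g x)
    have hgx : (g.quotKerEquivOfSurjective hg).symm (g x) = Submodule.Quotient.mk x := by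
      rw [LinearEquiv.symm_apply_eq]; rfl
    rw [LinearMap.comp_apply, LinearEquiv.coe_coe, hgx] at hx
    exact hx
  · intro a
    exact (extConnecting_eq_zero_iff hf h hg a).1 (Subsingleton.elim _ _)

-- Converse of `comp_bijective_of_subsingleton_ext`. Projectivity of `B` enters through `Ext¹(B, W)
-- = 0`, which makes every class in `Ext¹(C, W)` a connecting image of a map `A → W`.
include hf h hg in
theorem subsingleton_ext_of_comp_bijective [Module.Projective R B]
    (hb : Function.Bijective (fun b : B →ₗ[R] W => b ∘ₗ f)) :
    Subsingleton (Ext (ModuleCat.of R C) (ModuleCat.of R W) 0) ∧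
      Subsingleton (Ext (ModuleCat.of R C) (ModuleCat.of R W) 1) := by
  constructor
  · rw [subsingleton_ext_zero_iff]
    intro c
    have : c ∘ₗ g = 0 := hb.1 (LinearMap.ext fun a => by
      simp [h.apply_apply_eq_zero a])
    refine LinearMap.ext fun x => ?_
    obtain ⟨y, rfl⟩ := hg x
    exact LinearMap.congr_fun this y
  · refine subsingleton_of_forall_eq 0 fun x => ?_
    obtain ⟨a, rfl⟩ := extConnecting_surjective hf h hg (subsingleton_ext_of_projective 0) x
    exact (extConnecting_eq_zero_iff hf h hg a).2 (hb.2 a)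

/-- Dimension shifting: in the long exact sequence the neighbouring terms `Ext^{n+1}(B, W)` and
`Ext^{n+2}(B, W)` vanish. -/
theorem extClass_comp_bijective [Module.Projective R B] (n : ℕ) :
    Function.Bijective (fun x : Ext (ModuleCat.of R A) (ModuleCat.of R W) (n + 1) =>
      (linearShortComplex_shortExact hf h hg).extClass.comp x (add_comm 1 (n + 1))) := by
  constructor
  · refine (injective_iff_map_eq_zero ((linearShortComplex_shortExact hf h hg).extClass.precomp
      (ModuleCat.of R W) (add_comm 1 (n + 1)))).2 fun x hx => ?_
    obtain ⟨y, rfl⟩ := Ext.contravariant_sequence_exact₁ (linearShortComplex_shortExact hf h hg)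
      (ModuleCat.of R W) x (add_comm 1 (n + 1)) hx
    have : Subsingleton (Ext (ModuleCat.of R B) (ModuleCat.of R W) (n + 1)) :=
      subsingleton_ext_of_projective n
    rw [Subsingleton.elim y 0]
    exact Ext.comp_zero _ _ _ _ _
  · intro x
    exact Ext.contravariant_sequence_exact₃ (linearShortComplex_shortExact hf h hg)
      (ModuleCat.of R W) x (@Subsingleton.elim _ (subsingleton_ext_of_projective (n + 1)) _ _)
      (add_comm 1 (n + 1))

include hf h hg in
/-- Dimension shifting for an injective middle term. -/
theorem subsingleton_ext_succ_of_injective {Y : Type u} [AddCommGroup Y] [Module R Y]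
    [Module.Injective R B] (n : ℕ)
    (h2 : Subsingleton (Ext (ModuleCat.of R Y) (ModuleCat.of R A) (n + 2))) :
    Subsingleton (Ext (ModuleCat.of R Y) (ModuleCat.of R C) (n + 1)) := by
  refine subsingleton_of_forall_eq 0 fun x => ?_
  obtain ⟨y, rfl⟩ := Ext.covariant_sequence_exact₃ (ModuleCat.of R Y)
    (linearShortComplex_shortExact hf h hg) x rfl (Subsingleton.elim _ _)
  have : Subsingleton (Ext (ModuleCat.of R Y) (ModuleCat.of R B) (n + 1)) :=
    subsingleton_ext_of_injective n
  rw [Subsingleton.elim y 0, Ext.zero_comp]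

-- Here `A` has injective dimension at most one: `Ext²(Y, A)` sits between `Ext¹(Y, C)` and `Ext²(Y,
-- B)`.
include hf h hg in
theorem subsingleton_ext_two_of_injective {Y : Type u} [AddCommGroup Y] [Module R Y]
    [Module.Injective R B] [Module.Injective R C] :
    Subsingleton (Ext (ModuleCat.of R Y) (ModuleCat.of R A) 2) := by
  refine subsingleton_of_forall_eq 0 fun x => ?_
  obtain ⟨y, rfl⟩ := Ext.covariant_sequence_exact₁ (ModuleCat.of R Y)
    (linearShortComplex_shortExact hf h hg) x
    (@Subsingleton.elim _ (subsingleton_ext_of_injective 1) _ _) (n₀ := 1) rfl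
  have : Subsingleton (Ext (ModuleCat.of R Y) (ModuleCat.of R C) 1) :=
    subsingleton_ext_of_injective 0
  rw [Subsingleton.elim y 0, Ext.zero_comp]

-- `Ext¹(Y, A)` is a quotient of `Hom(Y, C)` because `Ext¹(Y, B) = 0`.
include hf h hg in
theorem subsingleton_ext_one_of_hom_eq_zero {Y : Type u} [AddCommGroup Y] [Module R Y]
    [Module.Injective R B] (hC : ∀ c : Y →ₗ[R] C, c = 0) :
    Subsingleton (Ext (ModuleCat.of R Y) (ModuleCat.of R A) 1) := by
  refine subsingleton_of_forall_eq 0 fun x => ?_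
  obtain ⟨y, rfl⟩ := Ext.covariant_sequence_exact₁ (ModuleCat.of R Y)
    (linearShortComplex_shortExact hf h hg) x
    (@Subsingleton.elim _ (subsingleton_ext_of_injective 0) _ _) (n₀ := 0) rfl
  have : Subsingleton (Ext (ModuleCat.of R Y) (ModuleCat.of R C) 0) :=
    subsingleton_ext_zero_iff.2 hC
  rw [Subsingleton.elim y 0, Ext.zero_comp]

include hf in
theorem exists_comp_eq_of_subsingleton_ext_one {Y : Type u} [AddCommGroup Y] [Module R Y]
    (h1 : Subsingleton (Ext (ModuleCat.of R Y) (ModuleCat.of R A) 1)) (h : Function.Exact f g)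
    (hg : Function.Surjective g) (c : Y →ₗ[R] C) : ∃ b : Y →ₗ[R] B, g ∘ₗ b = c := by
  obtain ⟨x, hx⟩ := Ext.covariant_sequence_exact₃ (ModuleCat.of R Y)
    (linearShortComplex_shortExact hf h hg) (Ext.mk₀ (ModuleCat.ofHom c)) rfl
    (Subsingleton.elim _ _)
  obtain ⟨b, rfl⟩ := (Ext.mk₀_bijective _ _).2 x
  rw [Ext.mk₀_comp_mk₀] at hx
  exact ⟨b.hom, congrArg ModuleCat.Hom.hom ((Ext.mk₀_bijective _ _).1 hx)⟩

end ShortExact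

/-! ### `Ext²` of a cokernel, computed from a two-term presentation. -/

section TwoStep

variable {P₁ P₀ X : Type u} [AddCommGroup P₁] [Module R P₁] [AddCommGroup P₀] [Module R P₀]
  [AddCommGroup X] [Module R X] {d : P₁ →ₗ[R] P₀} {e : P₀ →ₗ[R] X}

theorem exact_ker_rangeRestrict (d : P₁ →ₗ[R] P₀) :
    Function.Exact (LinearMap.ker d).subtype d.rangeRestrict := by
  rw [LinearMap.exact_iff, LinearMap.ker_rangeRestrict, Submodule.range_subtype]

theorem Function.Exact.range_subtype (h : Function.Exact d e) :
    Function.Exact (LinearMap.range d).subtype e := by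
  rw [LinearMap.exact_iff, Submodule.range_subtype, LinearMap.exact_iff.1 h]

variable {W : Type u} [AddCommGroup W] [Module R W] (h : Function.Exact d e)
  (he : Function.Surjective e)

/-- The iterated connecting map `Hom(Ker d, W) → Ext^2(Coker d, W)`. -/
noncomputable def extTwoConnecting (a : LinearMap.ker d →ₗ[R] W) :
    Ext (ModuleCat.of R X) (ModuleCat.of R W) 2 :=
  (linearShortComplex_shortExact (LinearMap.range d).injective_subtype
    h.range_subtype he).extClass.comp
    (extConnecting (LinearMap.ker d).injective_subtype (exact_ker_rangeRestrict d)
      d.surjective_rangeRestrict a) (add_comm 1 1)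

theorem extTwoConnecting_add (a b : LinearMap.ker d →ₗ[R] W) :
    extTwoConnecting h he (a + b) = extTwoConnecting h he a + extTwoConnecting h he b := by
  rw [extTwoConnecting, extConnecting_add, Ext.comp_add]; rfl

theorem extTwoConnecting_comp {W' : Type u} [AddCommGroup W'] [Module R W']
    (a : LinearMap.ker d →ₗ[R] W) (φ : W →ₗ[R] W') : extTwoConnecting h he (φ ∘ₗ a) =
      (extTwoConnecting h he a).comp (Ext.mk₀ (ModuleCat.ofHom φ)) (add_zero 2) := by
  rw [extTwoConnecting, extTwoConnecting, extConnecting_comp, Ext.comp_assoc_of_third_deg_zero]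

variable [Module.Projective R P₀]

theorem extTwoConnecting_surjective [Module.Projective R P₁] :
    Function.Surjective (extTwoConnecting (W := W) h he) :=
  (extClass_comp_bijective (LinearMap.range d).injective_subtype h.range_subtype he 0).2.comp
    (extConnecting_surjective (LinearMap.ker d).injective_subtype (exact_ker_rangeRestrict d)
      d.surjective_rangeRestrict (subsingleton_ext_of_projective 0))

/-- Together with surjectivity, this presents `Ext²(X, W)` as `Hom(Ker d, W)` modulo restrictions
from `P₁`. The dimension shift over `P₀` is injective, so only the obstruction in `Ext¹(Im d, W)`
remains. -/
theorem extTwoConnecting_eq_zero_iff (a : LinearMap.ker d →ₗ[R] W) :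
    extTwoConnecting h he a = 0 ↔ ∃ b : P₁ →ₗ[R] W, b ∘ₗ (LinearMap.ker d).subtype = a := by
  rw [← extConnecting_eq_zero_iff (LinearMap.ker d).injective_subtype (exact_ker_rangeRestrict d)
      d.surjective_rangeRestrict a]
  refine ⟨fun h0 => (extClass_comp_bijective (LinearMap.range d).injective_subtype
    h.range_subtype he 0).1 (h0.trans (Ext.comp_zero _ _ _ _ _).symm), fun h0 => ?_⟩
  rw [extTwoConnecting, h0, Ext.comp_zero]

end TwoStep

end ExtModule
/-! ### Flat dimension and character modules -/

section RightFree

variable (R : Type u) [Ring R]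

/-- `R` as a right module is the regular right module. -/
def opRegularEquiv : R ≃ₗ[Rᵐᵒᵖ] Rᵐᵒᵖ where
  __ := MulOpposite.opAddEquiv
  map_smul' _ _ := rfl

instance : Module.Free Rᵐᵒᵖ R := Module.Free.of_equiv (opRegularEquiv R).symm

instance : Module.Finite Rᵐᵒᵖ R := Module.Finite.equiv (opRegularEquiv R).symm

variable {R}

theorem exists_surjective_of_finite_right (X : Type u) [AddCommGroup X] [Module Rᵐᵒᵖ X]
    [Module.Finite Rᵐᵒᵖ X] :
    ∃ (n : ℕ) (f : (Fin n → R) →ₗ[Rᵐᵒᵖ] X), Function.Surjective f := by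
  obtain ⟨n, f, hf⟩ := Module.Finite.exists_fin' Rᵐᵒᵖ X
  exact ⟨n, f ∘ₗ (LinearEquiv.piCongrRight fun _ => opRegularEquiv R).toLinearMap,
    hf.comp (LinearEquiv.surjective _)⟩

/-- Every finite right module over a right Noetherian ring has a finite free presentation. -/
theorem exists_presentation_right [IsNoetherianRing Rᵐᵒᵖ] (X : Type u) [AddCommGroup X]
    [Module Rᵐᵒᵖ X] [Module.Finite Rᵐᵒᵖ X] :
    ∃ (n m : ℕ) (d : (Fin n → R) →ₗ[Rᵐᵒᵖ] (Fin m → R)) (e : (Fin m → R) →ₗ[Rᵐᵒᵖ] X),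
      Function.Exact d e ∧ Function.Surjective e := by
  obtain ⟨m, e, he⟩ := exists_surjective_of_finite_right (R := R) X
  obtain ⟨n, f, hf⟩ := exists_surjective_of_finite_right (R := R) (LinearMap.ker e)
  refine ⟨n, m, (LinearMap.ker e).subtype ∘ₗ f, e, ?_, he⟩
  rw [LinearMap.exact_iff, LinearMap.range_comp_of_range_eq_top _ (LinearMap.range_eq_top.2 hf),
    Submodule.range_subtype]

theorem right_apply_eq_sum {k : ℕ} {V : Type*} [AddCommGroup V] [Module Rᵐᵒᵖ V]
    (g : (Fin k → R) →ₗ[Rᵐᵒᵖ] V) (w : Fin k → R) :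
    g w = ∑ j, MulOpposite.op (w j) • g (Pi.single j 1) := by
  conv_lhs => rw [← Finset.univ_sum_single w]
  rw [map_sum]
  refine Finset.sum_congr rfl fun j _ => ?_
  rw [← map_smul, ← Pi.single_smul]
  simp

theorem left_apply_eq_sum {k : ℕ} {V : Type*} [AddCommGroup V] [Module R V]
    (g : (Fin k → R) →ₗ[R] V) (w : Fin k → R) :
    g w = ∑ j, w j • g (Pi.single j 1) := by
  conv_lhs => rw [← Finset.univ_sum_single w]
  rw [map_sum]
  refine Finset.sum_congr rfl fun j _ => ?_
  rw [← map_smul, ← Pi.single_smul]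
  simp

end RightFree

/-! ### Character modules, and flatness as injectivity of the character module. -/

section Character

variable {R : Type u} [Ring R]

/-- The character module of a left module is a right module. -/
instance CharacterModule.rightModule (M : Type v) [AddCommGroup M] [Module R M] :
    Module Rᵐᵒᵖ (CharacterModule M) where
  smul r c := (c : M →+ AddCircle (1 : ℚ)).comp (DistribSMul.toAddMonoidHom M r.unop)
  one_smul c := CharacterModule.ext M fun m => congrArg c (one_smul R m)
  mul_smul r s c := CharacterModule.ext M fun m => congrArg c (mul_smul s.unop r.unop m)
  smul_zero _ := rfl
  smul_add _ _ _ := rfl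
  add_smul r s c := CharacterModule.ext M fun m =>
    (congrArg c (add_smul r.unop s.unop m)).trans (map_add c _ _)
  zero_smul c := CharacterModule.ext M fun m =>
    (congrArg c (zero_smul R m)).trans (map_zero c)

@[simp]
theorem CharacterModule.op_smul_apply {M : Type v} [AddCommGroup M] [Module R M] (r : Rᵐᵒᵖ)
    (c : CharacterModule M) (m : M) : (r • c) m = c (r.unop • m) := rfl

theorem CharacterModule.add_apply_apply {M : Type v} [AddCommGroup M]
    (c c' : CharacterModule M) (m : M) : (c + c') m = c m + c' m := rfl

theorem CharacterModule.sum_apply {M : Type v} [AddCommGroup M] {ι : Type*} [Fintype ι]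
    (c : ι → CharacterModule M) (m : M) : (∑ j, c j) m = ∑ j, c j m :=
  map_sum (AddMonoidHom.mk' (fun c : CharacterModule M => c m) fun _ _ => rfl) c Finset.univ

/-- The transpose of a map of left modules on character modules. -/
def CharacterModule.rightDual {M N : Type v} [AddCommGroup M] [Module R M] [AddCommGroup N]
    [Module R N] (f : M →ₗ[R] N) : CharacterModule N →ₗ[Rᵐᵒᵖ] CharacterModule M where
  toFun c := (c : N →+ AddCircle (1 : ℚ)).comp f.toAddMonoidHom
  map_add' _ _ := rfl
  map_smul' r c := CharacterModule.ext M fun m => congrArg c (map_smul f r.unop m).symm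

/-- Characters extend along additive maps with smaller kernel. -/
theorem exists_character_comp_eq {A : Type*} {B : Type*} [AddCommGroup A] [AddCommGroup B]
    (f : A →+ B) (c : A →+ AddCircle (1 : ℚ)) (h : ∀ a, f a = 0 → c a = 0) :
    ∃ c' : B →+ AddCircle (1 : ℚ), ∀ a, c' (f a) = c a := by
  obtain ⟨k, hk⟩ := (Module.Baer.of_divisible
    (AddCircle (1 : ℚ))).exists_comp_eq_of_ker_le f.toIntLinearMap c.toIntLinearMap h
  exact ⟨k.toAddMonoidHom, fun a => LinearMap.congr_fun hk a⟩

section Exactness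

variable {M N L : Type v} [AddCommGroup M] [Module R M] [AddCommGroup N] [Module R N]
  [AddCommGroup L] [Module R L]

theorem CharacterModule.rightDual_injective {f : M →ₗ[R] N} (hf : Function.Surjective f) :
    Function.Injective (CharacterModule.rightDual f) := by
  intro c c' h
  refine CharacterModule.ext N fun n => ?_
  obtain ⟨m, rfl⟩ := hf n
  exact DFunLike.congr_fun h m

theorem CharacterModule.rightDual_surjective {f : M →ₗ[R] N} (hf : Function.Injective f) :
    Function.Surjective (CharacterModule.rightDual f) := by
  intro c
  obtain ⟨c', hc'⟩ := exists_character_comp_eq f.toAddMonoidHom (c : M →+ AddCircle (1 : ℚ))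
    fun a ha => by
      rw [show a = 0 from hf (ha.trans (map_zero f).symm)]; exact map_zero c
  exact ⟨c', CharacterModule.ext M hc'⟩

theorem CharacterModule.rightDual_exact {f : M →ₗ[R] N} {g : N →ₗ[R] L}
    (h : Function.Exact f g) :
    Function.Exact (CharacterModule.rightDual g) (CharacterModule.rightDual f) := by
  intro c
  constructor
  · intro hc
    obtain ⟨c', hc'⟩ := exists_character_comp_eq g.toAddMonoidHom (c : N →+ AddCircle (1 : ℚ))
      fun a ha => by
        obtain ⟨m, rfl⟩ := (h a).1 ha
        exact DFunLike.congr_fun hc m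
    exact ⟨c', CharacterModule.ext N hc'⟩
  · rintro ⟨c', rfl⟩
    refine CharacterModule.ext M fun m => ?_
    change c' (g (f m)) = 0
    rw [h.apply_apply_eq_zero, map_zero]

end Exactness

section Tensor

variable {X Y : Type u} [AddCommGroup X] [Module Rᵐᵒᵖ X] [AddCommGroup Y] [Module Rᵐᵒᵖ Y]
  {M : Type u} [AddCommGroup M] [Module R M]

/-- The class of `x ⊗ m` in the balanced tensor product. -/
def balancedTmul (x : X) (m : M) : BalancedTensor R X M :=
  QuotientAddGroup.mk (x ⊗ₜ[ℤ] m)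

theorem balancedTmul_smul (x : X) (r : R) (m : M) :
    balancedTmul (R := R) (MulOpposite.op r • x) m = balancedTmul x (r • m) := by
  refine (QuotientAddGroup.eq_iff_sub_mem).2 (AddSubgroup.subset_closure ⟨x, r, m, rfl⟩)

theorem balancedTmul_add (x : X) (m m' : M) :
    balancedTmul (R := R) x (m + m') = balancedTmul x m + balancedTmul x m' :=
  congrArg QuotientAddGroup.mk (TensorProduct.tmul_add x m m')

theorem add_balancedTmul (x x' : X) (m : M) :
    balancedTmul (R := R) (x + x') m = balancedTmul x m + balancedTmul x' m :=
  congrArg QuotientAddGroup.mk (TensorProduct.add_tmul x x' m)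

theorem BalancedTensor.map_tmul (f : X →ₗ[Rᵐᵒᵖ] Y) (x : X) (m : M) :
    BalancedTensor.map R M f (balancedTmul x m) = balancedTmul (f x) m := rfl

theorem BalancedTensor.addHom_ext {A : Type*} [AddCommGroup A] {f g : BalancedTensor R X M →+ A}
    (h : ∀ x m, f (balancedTmul x m) = g (balancedTmul x m)) : f = g := by
  refine QuotientAddGroup.addMonoidHom_ext _ (AddMonoidHom.ext fun t => ?_)
  induction t with
  | zero => rw [map_zero, map_zero]
  | tmul x m => exact h x m
  | add s t hs ht => rw [map_add, map_add, hs, ht]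

/-- A character of the tensor product as a map to the character module. -/
def characterCurry (c : BalancedTensor R X M →+ AddCircle (1 : ℚ)) :
    X →ₗ[Rᵐᵒᵖ] CharacterModule M where
  toFun x := AddMonoidHom.mk' (fun m => c (balancedTmul x m)) fun m m' => by
    rw [balancedTmul_add, map_add]
  map_add' x x' := CharacterModule.ext M fun m =>
    (congrArg c (add_balancedTmul x x' m)).trans (map_add c _ _)
  map_smul' r x := CharacterModule.ext M fun m =>
    congrArg c (balancedTmul_smul x r.unop m)

theorem characterCurry_apply (c : BalancedTensor R X M →+ AddCircle (1 : ℚ)) (x : X) (m : M) :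
    characterCurry c x m = c (balancedTmul x m) := rfl

/-- With `characterCurry`, this is the adjunction between characters of `X ⊗_R M` and maps from `X`
to the character module of `M`. -/
theorem exists_characterCurry_eq (g : X →ₗ[Rᵐᵒᵖ] CharacterModule M) :
    ∃ c : BalancedTensor R X M →+ AddCircle (1 : ℚ), ∀ x m, c (balancedTmul x m) = g x m := by
  let b : X →+ M →+ AddCircle (1 : ℚ) :=
    AddMonoidHom.mk' (fun x => (g x : M →+ AddCircle (1 : ℚ))) (map_add g)
  let t : X ⊗[ℤ] M →+ AddCircle (1 : ℚ) := TensorProduct.liftAddHom b fun r x m => by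
    change g (r • x) m = g x (r • m)
    rw [map_zsmul, map_zsmul]
    rfl
  refine ⟨QuotientAddGroup.lift _ t ?_, fun x m => ?_⟩
  · rw [balancedRelations, AddSubgroup.closure_le]
    rintro _ ⟨x, r, m, rfl⟩
    have : g (MulOpposite.op r • x) m = g x (r • m) := by rw [map_smul]; rfl
    change t _ = 0
    rw [map_sub, sub_eq_zero]
    exact this
  · rfl

/-- A module is flat if and only if its character module is injective. -/
theorem isFlatModule_iff_injective_character :
    IsFlatModule R M ↔ Module.Injective Rᵐᵒᵖ (CharacterModule M) := by
  constructor
  · intro hM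
    refine ⟨fun X Y _ _ _ _ f hf g => ?_⟩
    obtain ⟨c, hc⟩ := exists_characterCurry_eq g
    obtain ⟨c', hc'⟩ := exists_character_comp_eq (BalancedTensor.map R M f) c fun a ha => by
      have ha' := hM (ModuleCat.of Rᵐᵒᵖ X) (ModuleCat.of Rᵐᵒᵖ Y) f hf
        (ha.trans (map_zero (BalancedTensor.map R M f)).symm)
      rw [ha', map_zero]
    refine ⟨characterCurry c', fun x => CharacterModule.ext M fun m => ?_⟩
    rw [characterCurry_apply, ← BalancedTensor.map_tmul, hc', hc]
  · intro hM X Y f hf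
    -- A nonzero `t` is detected by a character `c`; injectivity of the character module factors `c`
    -- through the induced map of tensor products, which kills `t`.
    refine (injective_iff_map_eq_zero _).2 fun t ht => ?_
    by_contra hne
    obtain ⟨c, hc⟩ := CharacterModule.exists_character_apply_ne_zero_of_ne_zero hne
    obtain ⟨h, hh⟩ := hM.out f hf (characterCurry c)
    obtain ⟨c', hc'⟩ := exists_characterCurry_eq h
    have : c'.comp (BalancedTensor.map R M f) = c := BalancedTensor.addHom_ext fun x m => by
      rw [AddMonoidHom.comp_apply, BalancedTensor.map_tmul, hc', hh]; rfl
    apply hc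
    rw [← this]
    change c' (BalancedTensor.map R M f t) = 0
    rw [ht, map_zero]

end Tensor

/-- The character module of a free module is injective. -/
theorem injective_character_finsupp (ι : Type u) :
    Module.Injective Rᵐᵒᵖ (CharacterModule (ι →₀ R)) := by
  refine ⟨fun X Y _ _ _ _ f hf g => ?_⟩
  -- A map into the character module of a free module amounts to a family of additive characters,
  -- its values on the basis vectors. Each of these extends by divisibility of `ℚ/ℤ`, with no
  -- linearity to respect.
  have hψ : ∀ i, ∃ ψ : Y →+ AddCircle (1 : ℚ), ∀ x, ψ (f x) = g x (Finsupp.single i 1) :=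
    fun i => exists_character_comp_eq f.toAddMonoidHom
      (AddMonoidHom.mk' (fun x => g x (Finsupp.single i 1)) fun x y => by rw [map_add]; rfl)
      fun a ha => by
        have : a = 0 := hf (ha.trans (map_zero f).symm)
        rw [this, map_zero]
  choose ψ hψ using hψ
  let Φ : Y → CharacterModule (ι →₀ R) := fun y => Finsupp.liftAddHom fun i =>
    AddMonoidHom.mk' (fun r : R => ψ i (MulOpposite.op r • y)) fun r s => by
      rw [MulOpposite.op_add, add_smul, map_add]
  have hΦ : ∀ y i r, Φ y (Finsupp.single i r) = ψ i (MulOpposite.op r • y) :=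
    fun y i r => Finsupp.liftAddHom_apply_single _ _ _
  have hext : ∀ c c' : CharacterModule (ι →₀ R),
      (∀ i r, c (Finsupp.single i r) = c' (Finsupp.single i r)) → c = c' :=
    fun c c' h => Finsupp.addHom_ext h
  refine ⟨{ toFun := Φ, map_add' := fun y y' => ?_, map_smul' := fun s y => ?_ }, fun x => ?_⟩
  · refine hext _ _ fun i r => ?_
    rw [CharacterModule.add_apply_apply, hΦ, hΦ, hΦ, smul_add, map_add]
  · refine hext _ _ fun i r => ?_
    rw [RingHom.id_apply, CharacterModule.op_smul_apply, Finsupp.smul_single, hΦ, hΦ, smul_smul]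
    rfl
  · refine hext _ _ fun i r => (hΦ _ i r).trans ?_
    rw [← map_smul, hψ, map_smul, CharacterModule.op_smul_apply, Finsupp.smul_single]
    simp

/-- A module has flat dimension at most one if and only if its character module has injective
dimension at most one, tested on finitely generated modules. -/
theorem hasFlatDimensionLT_two_iff (I : ModuleCat.{u} R) :
    HasFlatDimensionLT R 2 I ↔ ∀ X : ModuleCat.{u} Rᵐᵒᵖ, Module.Finite Rᵐᵒᵖ X →
      Subsingleton (Ext X (ModuleCat.of Rᵐᵒᵖ (CharacterModule I)) 2) := by
  constructor
  · rintro ⟨F, p, hF, hp, F', q, hF', hq, hK⟩ X -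
    have : Module.Injective Rᵐᵒᵖ (CharacterModule F) := isFlatModule_iff_injective_character.1 hF
    have hK' : Module.Injective Rᵐᵒᵖ (CharacterModule F') :=
      isFlatModule_iff_injective_character.1 hF'
    -- Flat dimension `< 1` makes `q` an isomorphism, so `Ker p` is flat. Dualizing `0 → Ker p → F →
    -- I → 0` gives an injective coresolution of length one.
    have hqi : Function.Injective q :=
      LinearMap.ker_eq_bot.1 ((Submodule.subsingleton_iff_eq_bot).1 hK)
    let E := LinearEquiv.ofBijective q ⟨hqi, hq⟩
    have : Module.Injective Rᵐᵒᵖ (CharacterModule (LinearMap.ker p)) :=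
      hK'.of_retract (CharacterModule.rightDual E.toLinearMap)
        (CharacterModule.rightDual E.symm.toLinearMap) fun c => CharacterModule.ext _ fun m => by
          change c (E (E.symm m)) = c m
          rw [LinearEquiv.apply_symm_apply]
    exact subsingleton_ext_two_of_injective (Y := X) (CharacterModule.rightDual_injective hp)
      (CharacterModule.rightDual_exact p.exact_subtype_ker_map)
      (CharacterModule.rightDual_surjective (LinearMap.ker p).injective_subtype)
  · intro h
    let p : (I →₀ R) →ₗ[R] I := Finsupp.linearCombination R id
    have hp : Function.Surjective p := Finsupp.linearCombination_id_surjective R I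
    have := injective_character_finsupp (R := R) I
    have hK : Module.Injective Rᵐᵒᵖ (CharacterModule (LinearMap.ker p)) := by
      -- Baer's criterion involves only the cyclic modules `Rᵐᵒᵖ ⧸ J`, so the hypothesis on finitely
      -- generated modules suffices after one dimension shift.
      refine Module.Baer.injective fun J g => ?_
      have h1 : Subsingleton (Ext (ModuleCat.of Rᵐᵒᵖ (Rᵐᵒᵖ ⧸ J))
          (ModuleCat.of Rᵐᵒᵖ (CharacterModule (LinearMap.ker p))) 1) :=
        subsingleton_ext_succ_of_injective (CharacterModule.rightDual_injective hp)
          (CharacterModule.rightDual_exact p.exact_subtype_ker_map)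
          (CharacterModule.rightDual_surjective (LinearMap.ker p).injective_subtype) 0
          (h (ModuleCat.of Rᵐᵒᵖ (Rᵐᵒᵖ ⧸ J)) inferInstance)
      have hex : Function.Exact J.subtype J.mkQ := LinearMap.exact_subtype_mkQ J
      obtain ⟨k, hk⟩ := (extConnecting_eq_zero_iff J.injective_subtype hex J.mkQ_surjective g).1
        (Subsingleton.elim _ _)
      exact ⟨k, fun x hx => LinearMap.congr_fun hk ⟨x, hx⟩⟩
    refine ⟨ModuleCat.of R (I →₀ R), p, isFlatModule_iff_injective_character.2 this, hp,
      ModuleCat.of R (LinearMap.ker p), LinearMap.id,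
      isFlatModule_iff_injective_character.2 hK, fun x => ⟨x, rfl⟩, ?_⟩
    exact Submodule.subsingleton_iff_eq_bot.2 LinearMap.ker_id

end Character
/-! ### Maps from `Ext^2` to injective modules -/

section ExtDual

variable {R : Type u} [Ring R]

section Connecting

variable {P₁ P₀ X : Type u} [AddCommGroup P₁] [Module Rᵐᵒᵖ P₁] [AddCommGroup P₀]
  [Module Rᵐᵒᵖ P₀] [AddCommGroup X] [Module Rᵐᵒᵖ X] {d : P₁ →ₗ[Rᵐᵒᵖ] P₀} {e : P₀ →ₗ[Rᵐᵒᵖ] X}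

/-- The connecting map `Hom(Ker d, R) → Ext^2(Coker d, R)`, as a map of left modules. -/
noncomputable def extDualConnecting (h : Function.Exact d e) (he : Function.Surjective e) :
    (LinearMap.ker d →ₗ[Rᵐᵒᵖ] R) →ₗ[R] ExtDual R (ModuleCat.of Rᵐᵒᵖ X) 2 where
  toFun := extTwoConnecting h he
  map_add' := extTwoConnecting_add h he
  map_smul' r a := extTwoConnecting_comp h he a (leftMulEnd R r).hom

variable (h : Function.Exact d e) (he : Function.Surjective e)

theorem extDualConnecting_surjective [Module.Projective Rᵐᵒᵖ P₁] [Module.Projective Rᵐᵒᵖ P₀] :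
    Function.Surjective (extDualConnecting h he) :=
  extTwoConnecting_surjective h he

theorem extDualConnecting_eq_zero_iff [Module.Projective Rᵐᵒᵖ P₀]
    (a : LinearMap.ker d →ₗ[Rᵐᵒᵖ] R) : extDualConnecting h he a = 0 ↔
      ∃ b : P₁ →ₗ[Rᵐᵒᵖ] R, b ∘ₗ (LinearMap.ker d).subtype = a :=
  extTwoConnecting_eq_zero_iff h he a

-- Maps out of `Ext²(X, R)` are maps out of `Hom(Ker d, R)` killing the functionals that extend to
-- `P₁`.
include h he in
theorem forall_extDual_hom_eq_zero_iff [Module.Projective Rᵐᵒᵖ P₁] [Module.Projective Rᵐᵒᵖ P₀]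
    {I : Type u} [AddCommGroup I] [Module R I] :
    (∀ g : ExtDual R (ModuleCat.of Rᵐᵒᵖ X) 2 →ₗ[R] I, g = 0) ↔
      ∀ g : (LinearMap.ker d →ₗ[Rᵐᵒᵖ] R) →ₗ[R] I,
        (∀ b : P₁ →ₗ[Rᵐᵒᵖ] R, g (b ∘ₗ (LinearMap.ker d).subtype) = 0) → g = 0 := by
  have hsurj := extDualConnecting_surjective h he
  constructor
  · intro H g hg
    have hker : LinearMap.ker (extDualConnecting h he) ≤ LinearMap.ker g := fun a ha => by
      obtain ⟨b, rfl⟩ := (extDualConnecting_eq_zero_iff h he a).1 ha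
      exact hg b
    have hz := H ((LinearMap.ker (extDualConnecting h he)).liftQ g hker ∘ₗ
      ((extDualConnecting h he).quotKerEquivOfSurjective hsurj).symm.toLinearMap)
    refine LinearMap.ext fun a => ?_
    have hx := LinearMap.congr_fun hz (extDualConnecting h he a)
    have hgx : ((extDualConnecting h he).quotKerEquivOfSurjective hsurj).symm
        (extDualConnecting h he a) = Submodule.Quotient.mk a := by
      rw [LinearEquiv.symm_apply_eq]; rfl
    rw [LinearMap.comp_apply, LinearEquiv.coe_coe, hgx] at hx
    exact hx
  · intro H g
    have hz := H (g ∘ₗ extDualConnecting h he) fun b => by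
      rw [LinearMap.comp_apply, (extDualConnecting_eq_zero_iff h he _).2 ⟨b, rfl⟩, map_zero]
    refine LinearMap.ext fun x => ?_
    obtain ⟨a, rfl⟩ := hsurj x
    exact LinearMap.congr_fun hz a

end Connecting

/-- Maps from the dual of a finitely generated right module to an injective module are given by
elements of the tensor product. -/
theorem exists_hom_dual_eq_sum {V : Type*} [AddCommGroup V] [Module Rᵐᵒᵖ V] {k : ℕ}
    (b : (Fin k → R) →ₗ[Rᵐᵒᵖ] V) (hb : Function.Surjective b) {I : Type u} [AddCommGroup I]
    [Module R I] [Module.Injective R I] (g : (V →ₗ[Rᵐᵒᵖ] R) →ₗ[R] I) :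
    ∃ i : Fin k → I, ∀ f, g f = ∑ j, f (b (Pi.single j 1)) • i j := by
  -- Evaluation at the generators embeds the dual in `R^k`; injectivity of `I` extends `g` to `R^k`,
  -- where it is given by `k` elements.
  let τ : (V →ₗ[Rᵐᵒᵖ] R) →ₗ[R] (Fin k → R) :=
    { toFun := fun f j => f (b (Pi.single j 1))
      map_add' := fun _ _ => rfl
      map_smul' := fun _ _ => rfl }
  obtain ⟨g', hg'⟩ := Module.Injective.exists_comp_eq_of_ker_le τ g fun f hf => by
    have : f = 0 := by
      refine LinearMap.ext fun v => ?_
      obtain ⟨w, rfl⟩ := hb v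
      rw [← LinearMap.comp_apply, right_apply_eq_sum]
      refine Finset.sum_eq_zero fun j _ => ?_
      have hj : f (b (Pi.single j 1)) = 0 := congrFun hf j
      rw [LinearMap.comp_apply, hj, smul_zero]
    rw [this]; exact Submodule.zero_mem _
  refine ⟨fun j => g' (Pi.single j 1), fun f => ?_⟩
  rw [← hg', LinearMap.comp_apply, left_apply_eq_sum]
  rfl

variable {n m : ℕ} {d : (Fin n → R) →ₗ[Rᵐᵒᵖ] (Fin m → R)}
  {I : Type u} [AddCommGroup I] [Module R I] [Module.Injective R I]

/-- Write `g` as the tensor `∑ z_j ⊗ i_j` in `Ker d ⊗ I`. The condition `hg`, applied to the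
coordinate functionals, says that this tensor dies in `R^n ⊗ I`. A character on `Ker d ⊗ I` that
comes from `R^n ⊗ I` must therefore kill it, whereas a nonzero value `g f₀` would be detected by a
character `c` through `ψ z = c (f₀ z • -)`. -/
theorem hom_dual_eq_zero_of_character_extension [IsNoetherianRing Rᵐᵒᵖ]
    (H : ∀ ψ : LinearMap.ker d →ₗ[Rᵐᵒᵖ] CharacterModule I,
      ∃ Φ : (Fin n → R) →ₗ[Rᵐᵒᵖ] CharacterModule I, Φ ∘ₗ (LinearMap.ker d).subtype = ψ)
    (g : (LinearMap.ker d →ₗ[Rᵐᵒᵖ] R) →ₗ[R] I)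
    (hg : ∀ b : (Fin n → R) →ₗ[Rᵐᵒᵖ] R, g (b ∘ₗ (LinearMap.ker d).subtype) = 0) : g = 0 := by
  obtain ⟨k, b, hb⟩ := exists_surjective_of_finite_right (R := R) (LinearMap.ker d)
  obtain ⟨i, hi⟩ := exists_hom_dual_eq_sum b hb g
  by_contra hne
  obtain ⟨f₀, hf₀⟩ : ∃ f₀, g f₀ ≠ 0 := by
    by_contra! h; exact hne (LinearMap.ext h)
  obtain ⟨c, hc⟩ := CharacterModule.exists_character_apply_ne_zero_of_ne_zero hf₀
  let ψ : LinearMap.ker d →ₗ[Rᵐᵒᵖ] CharacterModule I :=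
    { toFun := fun z => (c : I →+ AddCircle (1 : ℚ)).comp (DistribSMul.toAddMonoidHom I (f₀ z))
      map_add' := fun z z' => CharacterModule.ext I fun x =>
        (congrArg c ((congrArg (· • x) (map_add f₀ z z')).trans (add_smul _ _ x))).trans
          (map_add c _ _)
      map_smul' := fun r z => CharacterModule.ext I fun x =>
        congrArg c ((congrArg (· • x) (map_smul f₀ r z)).trans (mul_smul (f₀ z) r.unop x)) }
  have hψ : ∀ z x, ψ z x = c (f₀ z • x) := fun _ _ => rfl
  obtain ⟨Φ, hΦ⟩ := H ψ
  apply hc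
  let z : Fin k → LinearMap.ker d := fun j => b (Pi.single j 1)
  calc c (g f₀) = ∑ j, ψ (z j) (i j) := by rw [hi, map_sum]; rfl
    _ = ∑ j, ∑ s, Φ (Pi.single s 1) ((z j : Fin n → R) s • i j) := by
        refine Finset.sum_congr rfl fun j _ => ?_
        rw [← hΦ, LinearMap.comp_apply, right_apply_eq_sum]
        exact CharacterModule.sum_apply _ _
    _ = ∑ s, Φ (Pi.single s 1) (g (LinearMap.proj s ∘ₗ (LinearMap.ker d).subtype)) := by
        rw [Finset.sum_comm]
        refine Finset.sum_congr rfl fun s _ => ?_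
        rw [hi, map_sum]
        rfl
    _ = 0 := Finset.sum_eq_zero fun s _ => by rw [hg, map_zero]

/-- `ψ` is a character on `Ker d ⊗ I`, here pulled back to `χ` on `I^k` along the generators `z_j`.
It extends to `R^n ⊗ I` once `χ` vanishes on the kernel of `ρ : I^k → R^n ⊗ I = I^n`, and this
kernel is what the hypothesis on `g` controls. -/
theorem character_extension_of_hom_dual_eq_zero [IsNoetherianRing Rᵐᵒᵖ]
    (H : ∀ g : (LinearMap.ker d →ₗ[Rᵐᵒᵖ] R) →ₗ[R] I,
      (∀ b : (Fin n → R) →ₗ[Rᵐᵒᵖ] R, g (b ∘ₗ (LinearMap.ker d).subtype) = 0) → g = 0)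
    (ψ : LinearMap.ker d →ₗ[Rᵐᵒᵖ] CharacterModule I) :
    ∃ Φ : (Fin n → R) →ₗ[Rᵐᵒᵖ] CharacterModule I, Φ ∘ₗ (LinearMap.ker d).subtype = ψ := by
  obtain ⟨l, k, t, b, htb, hb⟩ := exists_presentation_right (R := R) (LinearMap.ker d)
  let z : Fin k → LinearMap.ker d := fun j => b (Pi.single j 1)
  have hz : ∀ w : Fin k → R, b w = ∑ j, MulOpposite.op (w j) • z j := right_apply_eq_sum b
  let ρ : (Fin k → I) →+ (Fin n → I) :=
    AddMonoidHom.mk' (fun i s => ∑ j, (z j : Fin n → R) s • i j) fun i i' => by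
      ext s; simp [smul_add, Finset.sum_add_distrib]
  let χ : (Fin k → I) →+ AddCircle (1 : ℚ) :=
    AddMonoidHom.mk' (fun i => ∑ j, ψ (z j) (i j)) fun i i' => by
      simp [map_add, Finset.sum_add_distrib]
  have hker : ∀ i, ρ i = 0 → χ i = 0 := by
    intro i hi
    let g : (LinearMap.ker d →ₗ[Rᵐᵒᵖ] R) →ₗ[R] I :=
      { toFun := fun f => ∑ j, f (z j) • i j
        map_add' := fun f f' => by simp [add_smul, Finset.sum_add_distrib]
        map_smul' := fun r f => by simp [Finset.smul_sum, mul_smul] }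
    have hg : g = 0 := H g fun a => by
      have hsum : ∀ j, a (z j : Fin n → R) = ∑ s, a (Pi.single s 1) * (z j : Fin n → R) s :=
        fun j => right_apply_eq_sum a _
      change ∑ j, a (z j : Fin n → R) • i j = 0
      simp_rw [hsum, Finset.sum_smul, mul_smul]
      rw [Finset.sum_comm]
      refine Finset.sum_eq_zero fun s _ => ?_
      rw [← Finset.smul_sum]
      exact (congrArg _ (congrFun hi s)).trans (smul_zero _)
    let σ : (Fin k → R) →ₗ[R] I :=
      { toFun := fun v => ∑ j, v j • i j
        map_add' := fun f f' => by simp [add_smul, Finset.sum_add_distrib]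
        map_smul' := fun r f => by simp [Finset.smul_sum, mul_smul] }
    let τ : (Fin k → R) →ₗ[R] (Fin l → R) :=
      { toFun := fun v s => ∑ j, v j * t (Pi.single s 1) j
        map_add' := fun f f' => by ext; simp [add_mul, Finset.sum_add_distrib]
        map_smul' := fun r f => by ext; simp [Finset.mul_sum, mul_assoc] }
    -- A vector `v` in `Ker τ` respects the relations `t` among the `z_j`, so it is a functional on
    -- `Ker d`, and `g = 0` gives `σ v = 0`. Injectivity of `I` then factors `σ` through `τ`.
    obtain ⟨κ, hκ⟩ := Module.Injective.exists_comp_eq_of_ker_le τ σ fun v hv => by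
      let f' : (Fin k → R) →ₗ[Rᵐᵒᵖ] R :=
        { toFun := fun w => ∑ j, v j * w j
          map_add' := fun f f' => by simp [mul_add, Finset.sum_add_distrib]
          map_smul' := fun r f => by simp [Finset.sum_mul, mul_assoc] }
      have hf' : LinearMap.ker b ≤ LinearMap.ker f' := by
        rw [LinearMap.exact_iff.1 htb, LinearMap.range_le_ker_iff]
        refine LinearMap.ext fun w => ?_
        rw [right_apply_eq_sum]
        exact Finset.sum_eq_zero fun s _ =>
          (congrArg _ (congrFun hv s)).trans (smul_zero _)
      let f : LinearMap.ker d →ₗ[Rᵐᵒᵖ] R := (LinearMap.ker b).liftQ f' hf' ∘ₗ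
        (b.quotKerEquivOfSurjective hb).symm.toLinearMap
      have hf : ∀ j, f (z j) = v j := fun j => by
        have h1 : (b.quotKerEquivOfSurjective hb).symm (z j) =
            Submodule.Quotient.mk (Pi.single j 1) := by
          rw [LinearEquiv.symm_apply_eq]; rfl
        change (LinearMap.ker b).liftQ f' hf' ((b.quotKerEquivOfSurjective hb).symm (z j)) = v j
        rw [h1]
        change ∑ j', v j' * (Pi.single j 1 : Fin k → R) j' = v j
        simp [Pi.single_apply]
      have h2 : ∑ j, f (z j) • i j = 0 := LinearMap.congr_fun hg f
      simp_rw [hf] at h2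
      exact h2
    -- The factorization writes `i_j` through the relations: `∑ z_j ⊗ i_j = ∑_s b (t e_s) ⊗ κ e_s`,
    -- and `b ∘ t = 0`.
    have hij : ∀ j, i j = ∑ s, t (Pi.single s 1) j • κ (Pi.single s 1) := fun j => by
      have h1 : σ (Pi.single j 1) = i j := by
        change ∑ j', (Pi.single j 1 : Fin k → R) j' • i j' = i j
        simp [Pi.single_apply, ite_smul]
      rw [← h1, ← hκ, LinearMap.comp_apply, left_apply_eq_sum]
      refine Finset.sum_congr rfl fun s _ => ?_
      congr 1
      change ∑ j', (Pi.single j 1 : Fin k → R) j' * t (Pi.single s 1) j' = _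
      simp [Pi.single_apply]
    change ∑ j, ψ (z j) (i j) = 0
    simp_rw [hij, map_sum]
    rw [Finset.sum_comm]
    refine Finset.sum_eq_zero fun s _ => ?_
    have h0 : ψ (b (t (Pi.single s 1))) = 0 := by rw [htb.apply_apply_eq_zero, map_zero]
    have h1 : ψ (b (t (Pi.single s 1))) (κ (Pi.single s 1)) =
        ∑ j, ψ (z j) (t (Pi.single s 1) j • κ (Pi.single s 1)) := by
      rw [hz, map_sum]
      simp_rw [map_smul]
      exact CharacterModule.sum_apply _ _
    rw [← h1, h0]; rfl
  obtain ⟨χ', hχ'⟩ := exists_character_comp_eq ρ χ hker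
  let Φ : (Fin n → R) →ₗ[Rᵐᵒᵖ] CharacterModule I :=
    { toFun := fun p => AddMonoidHom.mk' (fun x => χ' fun s => p s • x) fun x y => by
        rw [← map_add]; congr 1; ext s; exact smul_add _ _ _
      map_add' := fun p q => CharacterModule.ext I fun x => by
        change χ' (fun s => (p + q) s • x) = χ' (fun s => p s • x) + χ' (fun s => q s • x)
        rw [← map_add]; congr 1; ext s; exact add_smul _ _ _
      map_smul' := fun r p => CharacterModule.ext I fun x => by
        change χ' (fun s => (r • p) s • x) = χ' (fun s => p s • r.unop • x)
        congr 1; ext s; exact mul_smul (p s) r.unop x }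
  refine ⟨Φ, LinearMap.ext fun y => CharacterModule.ext I fun x => ?_⟩
  obtain ⟨w, rfl⟩ := hb y
  have h1 : (fun s => ((b w : LinearMap.ker d) : Fin n → R) s • x) = ρ fun j => w j • x := by
    ext s
    change _ = ∑ j, (z j : Fin n → R) s • w j • x
    rw [hz]
    simp [Finset.sum_smul, mul_smul]
  change χ' (fun s => ((b w : LinearMap.ker d) : Fin n → R) s • x) = _
  rw [h1, hχ', hz, map_sum]
  simp_rw [map_smul]
  change ∑ j, ψ (z j) (w j • x) = _
  exact (CharacterModule.sum_apply (ι := Fin k) (fun j => MulOpposite.op (w j) • ψ (z j)) x).symm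

/-- An injective module has flat dimension at most one if and only if it receives no nonzero map
from the modules `Ext^2(X, R)`. -/
theorem hasFlatDimensionLT_two_iff_hom_extDual [IsNoetherianRing Rᵐᵒᵖ] (I : ModuleCat.{u} R)
    [Module.Injective R I] : HasFlatDimensionLT R 2 I ↔ ∀ X : ModuleCat.{u} Rᵐᵒᵖ,
      Module.Finite Rᵐᵒᵖ X → ∀ g : ExtDual R X 2 →ₗ[R] I, g = 0 := by
  rw [hasFlatDimensionLT_two_iff]
  refine forall_congr' fun X => forall_congr' fun hX => ?_
  obtain ⟨n, m, d, e, h, he⟩ := exists_presentation_right (R := R) X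
  refine Iff.trans ?_ (forall_extDual_hom_eq_zero_iff (X := X) h he).symm
  constructor
  · intro H
    exact hom_dual_eq_zero_of_character_extension fun ψ =>
      (extTwoConnecting_eq_zero_iff h he ψ).1 (Subsingleton.elim _ _)
  · intro H
    refine subsingleton_of_forall_eq 0 fun x => ?_
    obtain ⟨ψ, rfl⟩ := extTwoConnecting_surjective h he x
    exact (extTwoConnecting_eq_zero_iff h he ψ).2 (character_extension_of_hom_dual_eq_zero H ψ)

end ExtDual

/-! ### Strong grade and the minimal injective resolution -/

section StrongGrade

variable {R : Type u} [Ring R]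

theorem two_le_moduleGrade_iff (M : Type u) [AddCommGroup M] [Module R M] :
    2 ≤ moduleGrade R M ↔ Subsingleton (Ext (ModuleCat.of R M) (ModuleCat.of R R) 0) ∧
      Subsingleton (Ext (ModuleCat.of R M) (ModuleCat.of R R) 1) := by
  rw [moduleGrade, le_sInf_iff]
  constructor
  · intro h
    refine ⟨not_nontrivial_iff_subsingleton.1 fun h0 => ?_,
      not_nontrivial_iff_subsingleton.1 fun h0 => ?_⟩
    · exact absurd (h _ ⟨0, rfl, h0⟩) (by simp)
    · exact absurd (h _ ⟨1, rfl, h0⟩) (by norm_num)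
  · rintro ⟨h0, h1⟩ _ ⟨n, rfl, hn⟩
    match n, hn with
    | 0, hn => exact (not_subsingleton _ h0).elim
    | 1, hn => exact (not_subsingleton _ h1).elim
    | n + 2, _ => exact_mod_cast Nat.le_add_left 2 n

theorem two_le_strongGrade_iff (M : Type u) [AddCommGroup M] [Module R M] :
    2 ≤ strongGrade R M ↔ ∀ N : Submodule R M,
      Subsingleton (Ext (ModuleCat.of R N) (ModuleCat.of R R) 0) ∧
      Subsingleton (Ext (ModuleCat.of R N) (ModuleCat.of R R) 1) := by
  simp_rw [strongGrade, le_iInf_iff, two_le_moduleGrade_iff]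

variable {A E₀ E₁ : Type u} [AddCommGroup A] [Module R A] [AddCommGroup E₀] [Module R E₀]
  [AddCommGroup E₁] [Module R E₁] [Module.Injective R E₀] [Module.Injective R E₁]
  {i : A →ₗ[R] E₀} {d : E₀ →ₗ[R] E₁}

/-- Vanishing of `Ext^0` and `Ext^1` on all submodules, through the first two terms of a minimal
injective resolution. -/
theorem forall_submodule_subsingleton_ext_iff (hi : Function.Injective i)
    (hid : Function.Exact i d)
    (h₀ : ∀ N : Submodule R E₀, N ⊓ LinearMap.range i = ⊥ → N = ⊥)
    (h₁ : ∀ N : Submodule R E₁, N ⊓ LinearMap.range d = ⊥ → N = ⊥)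
    (M : Type u) [AddCommGroup M] [Module R M] :
    (∀ N : Submodule R M, Subsingleton (Ext (ModuleCat.of R N) (ModuleCat.of R A) 0) ∧
      Subsingleton (Ext (ModuleCat.of R N) (ModuleCat.of R A) 1)) ↔
    (∀ f : M →ₗ[R] E₀, f = 0) ∧ (∀ f : M →ₗ[R] E₁, f = 0) := by
  have hid' : Function.Exact i d.rangeRestrict := by
    rw [LinearMap.exact_iff, LinearMap.ker_rangeRestrict, LinearMap.exact_iff.1 hid]
  -- By essentiality, a nonzero map to `E` has image meeting `B`, hence is nonzero on the preimage
  -- of `B`, a submodule of `M`.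
  have key : ∀ {E : Type u} [AddCommGroup E] [Module R E] (B : Submodule R E)
      (_ : ∀ N : Submodule R E, N ⊓ B = ⊥ → N = ⊥)
      (_ : ∀ (N : Submodule R M) (f : N →ₗ[R] B), f = 0) (f : M →ₗ[R] E), f = 0 := by
    intro E _ _ B hB hN f
    refine LinearMap.range_eq_bot.1 (hB _ ((Submodule.eq_bot_iff _).2 ?_))
    rintro _ ⟨⟨x, rfl⟩, hx⟩
    exact congrArg Subtype.val (LinearMap.congr_fun (hN (B.comap f)
      ((f ∘ₗ (B.comap f).subtype).codRestrict B fun y => y.2)) ⟨x, hx⟩)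
  have extend : ∀ {E : Type u} [AddCommGroup E] [Module R E] [Module.Injective R E]
      (_ : ∀ f : M →ₗ[R] E, f = 0) (N : Submodule R M) (f : N →ₗ[R] E), f = 0 := by
    intro E _ _ _ hE N f
    obtain ⟨g, rfl⟩ := Module.Injective.extension_property R E N M N.subtype N.injective_subtype f
    rw [hE g, LinearMap.zero_comp]
  constructor
  · intro H
    have H₀ : ∀ f : M →ₗ[R] E₀, f = 0 := key _ h₀ fun N f => by
      have h := subsingleton_ext_zero_iff.1 (H N).1
        ((LinearEquiv.ofInjective i hi).symm.toLinearMap ∘ₗ f)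
      refine LinearMap.ext fun x => ?_
      exact (LinearEquiv.ofInjective i hi).symm.map_eq_zero_iff.1 (LinearMap.congr_fun h x)
    refine ⟨H₀, key _ h₁ fun N f => ?_⟩
    -- The obstruction to lifting `f : N → Im d` to `E₀` lies in `Ext¹(N, A) = 0`, and there are no
    -- nonzero maps `N → E₀`.
    obtain ⟨b, rfl⟩ := exists_comp_eq_of_subsingleton_ext_one hi (H N).2 hid'
      d.surjective_rangeRestrict f
    rw [extend H₀ N b, LinearMap.comp_zero]
  · rintro ⟨H₀, H₁⟩ N
    constructor
    · rw [subsingleton_ext_zero_iff]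
      intro f
      refine LinearMap.ext fun x => hi ?_
      rw [← LinearMap.comp_apply, extend H₀ N (i ∘ₗ f), LinearMap.zero_apply,
        LinearMap.zero_apply, map_zero]
    · refine subsingleton_ext_one_of_hom_eq_zero hi hid' d.surjective_rangeRestrict fun c => ?_
      refine LinearMap.ext fun x => Subtype.ext ?_
      exact LinearMap.congr_fun (extend H₁ N ((LinearMap.range d).subtype ∘ₗ c)) x

/-- For a minimal injective resolution `I`, the first two terms have flat dimension at most one if
and only if the strong grade condition holds. -/
theorem minimal_flatDimension_iff_strongGradeCondition [IsNoetherianRing Rᵐᵒᵖ]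
    (I : InjectiveResolution (ModuleCat.of R R)) (hI : IsMinimalInjectiveResolution R I) :
    (∀ i < 2, HasFlatDimensionLT R 2 (I.cocomplex.X i)) ↔ StrongGradeCondition R 2 2 := by
  have hinj : ∀ n, Module.Injective R (I.cocomplex.X n) := fun n => by
    have : CategoryTheory.Injective (ModuleCat.of R (I.cocomplex.X n)) := I.injective n
    exact Module.injective_module_of_injective_object R _
  let i : R →ₗ[R] I.cocomplex.X 0 := (I.ι.f 0).hom
  let d : I.cocomplex.X 0 →ₗ[R] I.cocomplex.X 1 := (I.cocomplex.d 0 1).hom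
  have hi : Function.Injective i := (ModuleCat.mono_iff_injective (I.ι.f 0)).1 inferInstance
  have hid : Function.Exact i d := by
    have : (ShortComplex.mk _ _ I.ι_f_zero_comp_complex_d).Exact :=
      ShortComplex.exact_of_f_is_kernel _ I.isLimitKernelFork
    exact (ShortComplex.ShortExact.moduleCat_exact_iff_function_exact _).1 this
  have hd : LinearMap.ker (I.cocomplex.d 1 2).hom = LinearMap.range d :=
    LinearMap.exact_iff.1
      ((ShortComplex.ShortExact.moduleCat_exact_iff_function_exact _).1 (I.exact_succ 0))
  have h₀ : ∀ N : Submodule R (I.cocomplex.X 0), N ⊓ LinearMap.range i = ⊥ → N = ⊥ := by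
    intro N hN
    rw [← LinearMap.exact_iff.1 hid] at hN
    exact hI 0 N hN
  have h₁ : ∀ N : Submodule R (I.cocomplex.X 1), N ⊓ LinearMap.range d = ⊥ → N = ⊥ := by
    intro N hN
    rw [← hd] at hN
    exact hI 1 N hN
  have hgrade : StrongGradeCondition R 2 2 ↔ ∀ X : ModuleCat.{u} Rᵐᵒᵖ, Module.Finite Rᵐᵒᵖ X →
      (∀ f : ExtDual R X 2 →ₗ[R] I.cocomplex.X 0, f = 0) ∧
      (∀ f : ExtDual R X 2 →ₗ[R] I.cocomplex.X 1, f = 0) :=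
    forall_congr' fun X => forall_congr' fun _ => (two_le_strongGrade_iff _).trans
      (forall_submodule_subsingleton_ext_iff hi hid h₀ h₁ _)
  rw [hgrade]
  constructor
  · intro H X hX
    exact ⟨(hasFlatDimensionLT_two_iff_hom_extDual _).1 (H 0 (by norm_num)) X hX,
      (hasFlatDimensionLT_two_iff_hom_extDual _).1 (H 1 (by norm_num)) X hX⟩
  · intro H j hj
    rw [hasFlatDimensionLT_two_iff_hom_extDual]
    intro X hX
    match j, hj with
    | 0, _ => exact (H X hX).1
    | 1, _ => exact (H X hX).2

/-- The preceding equivalence holds for every minimal injective resolution, so uniqueness of such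
resolutions plays no role; `minResolution` supplies one for the converse. -/
theorem auslanderCondition_iff_strongGradeCondition (R : Type u) [Ring R]
    [IsNoetherianRing Rᵐᵒᵖ] : AuslanderCondition R 2 2 ↔ StrongGradeCondition R 2 2 := by
  constructor
  · rintro ⟨I, hI, h⟩
    exact (minimal_flatDimension_iff_strongGradeCondition I hI).1 h
  · intro h
    have hI := minResolution_isMinimal R (ModuleCat.of R R)
    exact ⟨_, hI, (minimal_flatDimension_iff_strongGradeCondition _ hI).2 h⟩

end StrongGrade
/-! ### Biduals and the strong grade condition -/

section Bidual

variable {R : Type u} [Ring R]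

/-- A submodule `I` of `L` such that every map `I → R` extends uniquely to `L`. -/
def IsDualDense {L : Type*} [AddCommGroup L] [Module R L] (I : Submodule R L) : Prop :=
  Function.Bijective (fun f : L →ₗ[R] R => f ∘ₗ I.subtype)

theorem finite_dual_right [IsNoetherianRing R] (X : Type u) [AddCommGroup X] [Module Rᵐᵒᵖ X]
    [Module.Finite Rᵐᵒᵖ X] : Module.Finite R (X →ₗ[Rᵐᵒᵖ] R) := by
  obtain ⟨k, b, hb⟩ := exists_surjective_of_finite_right (R := R) X
  let τ : (X →ₗ[Rᵐᵒᵖ] R) →ₗ[R] (Fin k → R) :=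
    { toFun := fun f j => f (b (Pi.single j 1))
      map_add' := fun _ _ => rfl
      map_smul' := fun _ _ => rfl }
  refine Module.Finite.of_injective τ fun f f' hff => LinearMap.ext fun x => ?_
  obtain ⟨w, rfl⟩ := hb x
  rw [← LinearMap.comp_apply, ← LinearMap.comp_apply, right_apply_eq_sum, right_apply_eq_sum]
  exact Finset.sum_congr rfl fun j _ => congrArg _ (congrFun hff j)

theorem finite_dual_left [IsNoetherianRing Rᵐᵒᵖ] (M : Type u) [AddCommGroup M] [Module R M]
    [Module.Finite R M] : Module.Finite Rᵐᵒᵖ (M →ₗ[R] R) := by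
  obtain ⟨k, b, hb⟩ := Module.Finite.exists_fin' R M
  let τ : (M →ₗ[R] R) →ₗ[Rᵐᵒᵖ] (Fin k → R) :=
    { toFun := fun f j => f (b (Pi.single j 1))
      map_add' := fun _ _ => rfl
      map_smul' := fun _ _ => rfl }
  refine Module.Finite.of_injective τ fun f f' hff => LinearMap.ext fun x => ?_
  obtain ⟨w, rfl⟩ := hb x
  rw [← LinearMap.comp_apply, ← LinearMap.comp_apply, left_apply_eq_sum, left_apply_eq_sum]
  exact Finset.sum_congr rfl fun j _ => congrArg _ (congrFun hff j)

variable (R) in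
/-- The functional on `R^n` given by right multiplication with a vector. -/
def dotRight {n : ℕ} (p : Fin n → R) : (Fin n → R) →ₗ[R] R where
  toFun x := ∑ j, x j * p j
  map_add' x y := by simp [add_mul, Finset.sum_add_distrib]
  map_smul' r x := by simp [Finset.mul_sum, mul_assoc]

variable (R) in
/-- The functional on the right module `R^n` given by left multiplication with a vector. -/
def dotLeft {n : ℕ} (x : Fin n → R) : (Fin n → R) →ₗ[Rᵐᵒᵖ] R where
  toFun p := ∑ j, x j * p j
  map_add' x y := by simp [mul_add, Finset.sum_add_distrib]
  map_smul' r x := by simp [Finset.sum_mul, mul_assoc]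

section Transpose

variable {n m : ℕ} {d : (Fin n → R) →ₗ[Rᵐᵒᵖ] (Fin m → R)}
  {X : Type u} [AddCommGroup X] [Module Rᵐᵒᵖ X] {e : (Fin m → R) →ₗ[Rᵐᵒᵖ] X}
  {M : Type u} [AddCommGroup M] [Module R M] {π : (Fin n → R) →ₗ[R] M}

/-- If `M` is the transpose of `X`, the cokernel of `M → M**` is `Ext^2(X, R)`. -/
theorem exists_bidual_to_extDual (h : Function.Exact d e) (he : Function.Surjective e)
    (hπ : Function.Surjective π)
    (hd : ∀ p, d p = 0 ↔ ∀ x, π x = 0 → dotRight R p x = 0) :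
    ∃ δ : ((M →ₗ[R] R) →ₗ[Rᵐᵒᵖ] R) →ₗ[R] ExtDual R (ModuleCat.of Rᵐᵒᵖ X) 2,
      Function.Surjective δ ∧ LinearMap.ker δ = LinearMap.range (bidualEval R M) := by
  have hfπ : ∀ (f : M →ₗ[R] R) (x : Fin n → R),
      f (π x) = dotRight R (fun j => f (π (Pi.single j 1))) x :=
    fun f x => left_apply_eq_sum (f ∘ₗ π) x
  -- A functional on `M` is the vector of its values on the generators, subject to killing `Ker π`;
  -- by `hd` these vectors form `Ker d`. So `M* ≅ Ker d` and `M** ≅ Hom(Ker d, R)`.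
  let ε₀ : (M →ₗ[R] R) →ₗ[Rᵐᵒᵖ] LinearMap.ker d :=
    { toFun := fun f => ⟨fun j => f (π (Pi.single j 1)), (hd _).2 fun x hx => by
        rw [← hfπ, hx, map_zero]⟩
      map_add' := fun _ _ => rfl
      map_smul' := fun _ _ => rfl }
  have hε₀ : Function.Bijective ε₀ := by
    constructor
    · intro f f' hff
      refine LinearMap.ext fun y => ?_
      obtain ⟨x, rfl⟩ := hπ y
      rw [hfπ, hfπ]
      exact congrArg (fun p => dotRight R p x) (congrArg Subtype.val hff)
    · rintro ⟨p, hp⟩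
      have hker : LinearMap.ker π ≤ LinearMap.ker (dotRight R p) := (hd p).1 hp
      refine ⟨(LinearMap.ker π).liftQ (dotRight R p) hker ∘ₗ
        (π.quotKerEquivOfSurjective hπ).symm.toLinearMap, Subtype.ext (funext fun j => ?_)⟩
      have h1 : (π.quotKerEquivOfSurjective hπ).symm (π (Pi.single j 1)) =
          Submodule.Quotient.mk (Pi.single j 1) := by
        rw [LinearEquiv.symm_apply_eq]; rfl
      change (LinearMap.ker π).liftQ (dotRight R p) hker
        ((π.quotKerEquivOfSurjective hπ).symm (π (Pi.single j 1))) = p j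
      rw [h1]
      change ∑ i, (Pi.single j 1 : Fin n → R) i * p i = p j
      simp [Pi.single_apply]
  let ε := LinearEquiv.ofBijective ε₀ hε₀
  let pre : ((M →ₗ[R] R) →ₗ[Rᵐᵒᵖ] R) →ₗ[R] (LinearMap.ker d →ₗ[Rᵐᵒᵖ] R) :=
    { toFun := fun ψ => ψ ∘ₗ ε.symm.toLinearMap
      map_add' := fun _ _ => rfl
      map_smul' := fun _ _ => rfl }
  have hpre : Function.Surjective pre := fun a => ⟨a ∘ₗ ε.toLinearMap, by
    refine LinearMap.ext fun z => ?_
    exact congrArg a (ε.apply_symm_apply z)⟩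
  refine ⟨extDualConnecting h he ∘ₗ pre, (extDualConnecting_surjective h he).comp hpre, ?_⟩
  ext ψ
  rw [LinearMap.mem_ker, LinearMap.comp_apply, extDualConnecting_eq_zero_iff]
  have hval : ∀ (c : Fin n → R) (f : M →ₗ[R] R),
      dotLeft R c (ε f : Fin n → R) = f (π c) := fun c f => (hfπ f c).symm
  constructor
  · rintro ⟨b, hb⟩
    -- An extension `b : R^n → R` is left multiplication by a row vector, and the corresponding
    -- element of `M**` is evaluation at the image of that vector under `π`.
    refine ⟨π fun j => b (Pi.single j 1), LinearMap.ext fun f => ?_⟩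
    have h1 : b (ε f : Fin n → R) = ψ f :=
      (LinearMap.congr_fun hb (ε f)).trans (congrArg ψ (ε.symm_apply_apply f))
    rw [← h1, right_apply_eq_sum]
    exact (hval _ f).symm
  · rintro ⟨y, rfl⟩
    obtain ⟨c, rfl⟩ := hπ y
    refine ⟨dotLeft R c, LinearMap.ext fun z => ?_⟩
    obtain ⟨f, rfl⟩ := ε.surjective z
    refine (hval c f).trans ?_
    exact (congrArg (fun f : M →ₗ[R] R => f (π c)) (ε.symm_apply_apply f)).symm

end Transpose

/-- `M` is the Auslander transpose of `X`: the left module whose relations are the rows of the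
matrix of `d`. -/
theorem exists_bidual_of_right [IsNoetherianRing Rᵐᵒᵖ] (X : ModuleCat.{u} Rᵐᵒᵖ)
    [Module.Finite Rᵐᵒᵖ X] : ∃ M : ModuleCat.{u} R, Module.Finite R M ∧
      ∃ δ : ((M →ₗ[R] R) →ₗ[Rᵐᵒᵖ] R) →ₗ[R] ExtDual R X 2,
      Function.Surjective δ ∧ LinearMap.ker δ = LinearMap.range (bidualEval R M) := by
  obtain ⟨n, m, d, e, h, he⟩ := exists_presentation_right (R := R) X
  let a : Fin m → Fin n → R := fun s j => d (Pi.single j 1) s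
  let K : Submodule R (Fin n → R) := Submodule.span R (Set.range a)
  refine ⟨ModuleCat.of R ((Fin n → R) ⧸ K), inferInstance,
    exists_bidual_to_extDual (X := X) h he K.mkQ_surjective fun p => ?_⟩
  have hda : ∀ s, d p s = dotRight R p (a s) := fun s => by
    rw [right_apply_eq_sum d p, Finset.sum_apply]; rfl
  have hspan : (∀ x, K.mkQ x = 0 → dotRight R p x = 0) ↔ K ≤ LinearMap.ker (dotRight R p) := by
    simp [SetLike.le_def]
  rw [hspan, Submodule.span_le, Set.range_subset_iff, funext_iff]
  exact forall_congr' fun s => by rw [hda]; rfl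

/-- The transpose in the other direction: `X` is the cokernel of the transposed relation matrix of
`M`. -/
theorem exists_right_of_bidual [IsNoetherianRing R] (M : ModuleCat.{u} R)
    [Module.Finite R M] : ∃ X : ModuleCat.{u} Rᵐᵒᵖ, Module.Finite Rᵐᵒᵖ X ∧
      ∃ δ : ((M →ₗ[R] R) →ₗ[Rᵐᵒᵖ] R) →ₗ[R] ExtDual R X 2,
      Function.Surjective δ ∧ LinearMap.ker δ = LinearMap.range (bidualEval R M) := by
  obtain ⟨n, π, hπ⟩ := Module.Finite.exists_fin' R M
  obtain ⟨m, y, hy⟩ := Module.Finite.exists_fin' R (LinearMap.ker π)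
  let d : (Fin n → R) →ₗ[Rᵐᵒᵖ] (Fin m → R) :=
    LinearMap.pi fun s => dotLeft R (y (Pi.single s 1) : Fin n → R)
  refine ⟨ModuleCat.of Rᵐᵒᵖ ((Fin m → R) ⧸ LinearMap.range d), inferInstance,
    exists_bidual_to_extDual (d := d) (e := (LinearMap.range d).mkQ)
      (LinearMap.exact_map_mkQ_range d) (Submodule.mkQ_surjective _) hπ fun p => ?_⟩
  constructor
  · intro hp x hx
    obtain ⟨w, hw⟩ := hy ⟨x, hx⟩
    have h1 : dotRight R p ((LinearMap.ker π).subtype (y w)) = 0 := by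
      rw [← LinearMap.comp_apply, ← LinearMap.comp_apply, left_apply_eq_sum]
      exact Finset.sum_eq_zero fun s _ => (congrArg _ (congrFun hp s)).trans (smul_zero _)
    rw [hw] at h1
    exact h1
  · intro hp
    exact funext fun s => hp _ (y (Pi.single s 1)).2

variable (R) in
/-- Every preimage of `M` in `M**` under a map to `M**` is dual dense. -/
def BidualCondition : Prop :=
  ∀ M : ModuleCat.{u} R, Module.Finite R M → ∀ (F : Type u) [AddCommGroup F] [Module R F]
    (g : F →ₗ[R] ((M →ₗ[R] R) →ₗ[Rᵐᵒᵖ] R)),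
    IsDualDense ((LinearMap.range (bidualEval R M)).comap g)

/-- The quotient of `F` by the preimage of `M` is the image of `F` in `Ext²(X, R)`, a submodule on
which `Hom(-, R)` and `Ext¹(-, R)` vanish. -/
theorem bidualCondition_of_strongGradeCondition [IsNoetherianRing R]
    (H : StrongGradeCondition R 2 2) : BidualCondition R := by
  intro M hM F _ _ g
  obtain ⟨X, hX, δ, hδ, hker⟩ := exists_right_of_bidual M
  have hN := (two_le_strongGrade_iff _).1 (H X hX) (LinearMap.range (δ ∘ₗ g))
  refine comp_bijective_of_subsingleton_ext (Submodule.injective_subtype _) ?_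
    (δ ∘ₗ g).surjective_rangeRestrict hN.1 hN.2
  rw [LinearMap.exact_iff, LinearMap.ker_rangeRestrict, LinearMap.ker_comp, hker,
    Submodule.range_subtype]

/-- A finite free cover of a submodule `N` of `Ext²(X, R)` lifts to `M**`, and the kernel of the
cover is the preimage of the image of `M`. Thus finite free sources already suffice, and their
projectivity turns unique extension into vanishing of `Ext`. -/
theorem strongGradeCondition_of_isDualDense [IsNoetherianRing R] [IsNoetherianRing Rᵐᵒᵖ]
    (H : ∀ M : ModuleCat.{u} R, Module.Finite R M → ∀ (k : ℕ)
      (g : (Fin k → R) →ₗ[R] ((M →ₗ[R] R) →ₗ[Rᵐᵒᵖ] R)),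
      IsDualDense ((LinearMap.range (bidualEval R M)).comap g)) :
    StrongGradeCondition R 2 2 := by
  intro X hX
  obtain ⟨M, hM, δ, hδ, hker⟩ := exists_bidual_of_right X
  refine (two_le_strongGrade_iff _).2 fun N => ?_
  have := finite_dual_left (R := R) M
  have := finite_dual_right (R := R) (M →ₗ[R] R)
  have : Module.Finite R (ExtDual R X 2) := Module.Finite.of_surjective δ hδ
  obtain ⟨k, q, hq⟩ := Module.Finite.exists_fin' R N
  obtain ⟨g, hg⟩ := Module.projective_lifting_property δ (N.subtype ∘ₗ q) hδ
  refine subsingleton_ext_of_comp_bijective (Submodule.injective_subtype _) ?_ hq (H M hM k g)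
  rw [LinearMap.exact_iff, Submodule.range_subtype, ← hker, ← LinearMap.ker_comp, hg,
    LinearMap.ker_comp_of_ker_eq_bot _ N.ker_subtype]

end Bidual
/-! ### Reflexive modules and dual dense submodules -/

section ReflexiveModules

variable {R : Type u} [Ring R]

theorem bidualEval_apply {M : Type v} [AddCommGroup M] [Module R M] (m : M) (f : M →ₗ[R] R) :
    bidualEval R M m f = f m := rfl

theorem eq_of_forall_dual_eq {M : Type v} [AddCommGroup M] [Module R M]
    (hM : Function.Injective (bidualEval R M)) {x y : M} (h : ∀ f : M →ₗ[R] R, f x = f y) :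
    x = y :=
  hM (LinearMap.ext h)

theorem bidualEval_self_bijective : Function.Bijective (bidualEval R R) := by
  constructor
  · intro x y h
    exact LinearMap.congr_fun h LinearMap.id
  · intro ψ
    refine ⟨ψ LinearMap.id, LinearMap.ext fun f => ?_⟩
    have hf : f = MulOpposite.op (f 1) • (LinearMap.id : R →ₗ[R] R) :=
      LinearMap.ext_ring (by simp)
    conv_rhs => rw [hf, map_smul]
    rw [bidualEval_apply]
    conv_lhs => rw [hf]
    simp

theorem bidualEval_pi_bijective (k : ℕ) : Function.Bijective (bidualEval R (Fin k → R)) := by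
  constructor
  · intro x y h
    exact funext fun j => LinearMap.congr_fun h (LinearMap.proj j)
  · intro ψ
    refine ⟨fun j => ψ (LinearMap.proj j), LinearMap.ext fun f => ?_⟩
    have hf : f = ∑ j, MulOpposite.op (f (Pi.single j 1)) •
        (LinearMap.proj j : (Fin k → R) →ₗ[R] R) := by
      refine LinearMap.ext fun x => ?_
      rw [left_apply_eq_sum]
      simp
    conv_rhs => rw [hf, map_sum]
    rw [bidualEval_apply, left_apply_eq_sum]
    exact Finset.sum_congr rfl fun j _ => (map_smul ψ _ _).symm

theorem bidualEval_prod_bijective {M N : Type v} [AddCommGroup M] [Module R M] [AddCommGroup N]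
    [Module R N] (hM : Function.Bijective (bidualEval R M))
    (hN : Function.Bijective (bidualEval R N)) : Function.Bijective (bidualEval R (M × N)) := by
  constructor
  · intro x y h
    refine Prod.ext (eq_of_forall_dual_eq hM.1 fun f => ?_)
      (eq_of_forall_dual_eq hN.1 fun f => ?_)
    · exact LinearMap.congr_fun h (f ∘ₗ LinearMap.fst R M N)
    · exact LinearMap.congr_fun h (f ∘ₗ LinearMap.snd R M N)
  · intro ψ
    obtain ⟨m, hm⟩ := hM.2
      { toFun := fun f => ψ (f ∘ₗ LinearMap.fst R M N)
        map_add' := fun f g => map_add ψ (f ∘ₗ LinearMap.fst R M N) (g ∘ₗ LinearMap.fst R M N)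
        map_smul' := fun r f => map_smul ψ r (f ∘ₗ LinearMap.fst R M N) }
    obtain ⟨n, hn⟩ := hN.2
      { toFun := fun f => ψ (f ∘ₗ LinearMap.snd R M N)
        map_add' := fun f g => map_add ψ (f ∘ₗ LinearMap.snd R M N) (g ∘ₗ LinearMap.snd R M N)
        map_smul' := fun r f => map_smul ψ r (f ∘ₗ LinearMap.snd R M N) }
    refine ⟨(m, n), LinearMap.ext fun f => ?_⟩
    have hf : f = (f ∘ₗ LinearMap.inl R M N) ∘ₗ LinearMap.fst R M N +
        (f ∘ₗ LinearMap.inr R M N) ∘ₗ LinearMap.snd R M N := by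
      refine LinearMap.ext fun x => ?_
      simp [← map_add]
    have h1 : f (m, 0) = ψ ((f ∘ₗ LinearMap.inl R M N) ∘ₗ LinearMap.fst R M N) :=
      LinearMap.congr_fun hm (f ∘ₗ LinearMap.inl R M N)
    have h2 : f (0, n) = ψ ((f ∘ₗ LinearMap.inr R M N) ∘ₗ LinearMap.snd R M N) :=
      LinearMap.congr_fun hn (f ∘ₗ LinearMap.inr R M N)
    conv_rhs => rw [hf, map_add, ← h1, ← h2, ← map_add]
    simp [bidualEval_apply]

/-! ### Dual dense submodules and extension of maps to reflexive modules. -/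

section Dense

variable {L : Type v} [AddCommGroup L] [Module R L] {I : Submodule R L}

/-- Restriction of functionals to a dual dense submodule, as an equivalence of right modules. -/
noncomputable def IsDualDense.restrictEquiv (hI : IsDualDense I) :
    (L →ₗ[R] R) ≃ₗ[Rᵐᵒᵖ] (I →ₗ[R] R) :=
  LinearEquiv.ofBijective
    { toFun := fun f => f ∘ₗ I.subtype
      map_add' := fun _ _ => rfl
      map_smul' := fun _ _ => rfl } hI

theorem IsDualDense.restrictEquiv_symm_apply (hI : IsDualDense I) (f : I →ₗ[R] R) (x : I) :
    hI.restrictEquiv.symm f x = f x :=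
  LinearMap.congr_fun (hI.restrictEquiv.apply_symm_apply f) x

/-- The map `L → I**` extending the evaluation map of a dual dense submodule `I`. -/
noncomputable def IsDualDense.toBidual (hI : IsDualDense I) :
    L →ₗ[R] ((I →ₗ[R] R) →ₗ[Rᵐᵒᵖ] R) where
  toFun l := bidualEval R L l ∘ₗ hI.restrictEquiv.symm.toLinearMap
  map_add' x y := by rw [map_add, LinearMap.add_comp]
  map_smul' r x := by rw [map_smul, LinearMap.smul_comp, RingHom.id_apply]

theorem IsDualDense.toBidual_apply (hI : IsDualDense I) (l : L) (f : I →ₗ[R] R) :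
    hI.toBidual l f = hI.restrictEquiv.symm f l := rfl

/-- Functionals separate the points of `L`, so a point acting on `I*` as an element of `I` is that
element. Every dual dense `I` thus has the form to which `BidualCondition`, applied to `I` itself,
refers. -/
theorem IsDualDense.comap_toBidual (hI : IsDualDense I)
    (hL : Function.Injective (bidualEval R L)) :
    (LinearMap.range (bidualEval R I)).comap hI.toBidual = I := by
  ext l
  constructor
  · rintro ⟨i, hi⟩
    have : (i : L) = l := eq_of_forall_dual_eq hL fun f => by
      have h := LinearMap.congr_fun hi (hI.restrictEquiv f)
      rw [hI.toBidual_apply, LinearEquiv.symm_apply_apply] at h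
      exact h
    exact this ▸ i.2
  · intro hl
    exact ⟨⟨l, hl⟩, LinearMap.ext fun f => (hI.restrictEquiv_symm_apply f ⟨l, hl⟩).symm⟩

/-- Maps from a dual dense submodule to a reflexive module extend uniquely. -/
theorem IsDualDense.comp_subtype_bijective (hI : IsDualDense I) {W : Type*} [AddCommGroup W]
    [Module R W] (hW : Function.Bijective (bidualEval R W)) :
    Function.Bijective (fun f : L →ₗ[R] W => f ∘ₗ I.subtype) := by
  constructor
  · intro f f' h
    refine LinearMap.ext fun x => eq_of_forall_dual_eq hW.1 fun φ => ?_
    have : φ ∘ₗ f = φ ∘ₗ f' := hI.1 (by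
      refine LinearMap.ext fun y => ?_
      exact congrArg φ (LinearMap.congr_fun h y))
    exact LinearMap.congr_fun this x
  · intro h
    let evW := LinearEquiv.ofBijective (bidualEval R W) hW
    let pre : ((I →ₗ[R] R) →ₗ[Rᵐᵒᵖ] R) →ₗ[R] ((W →ₗ[R] R) →ₗ[Rᵐᵒᵖ] R) :=
      { toFun := fun ψ => ψ ∘ₗ
          { toFun := fun φ => φ ∘ₗ h, map_add' := fun _ _ => rfl, map_smul' := fun _ _ => rfl }
        map_add' := fun _ _ => rfl
        map_smul' := fun _ _ => rfl }
    refine ⟨evW.symm.toLinearMap ∘ₗ pre ∘ₗ hI.toBidual, LinearMap.ext fun x => ?_⟩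
    refine evW.injective ((evW.apply_symm_apply _).trans (LinearMap.ext fun φ => ?_))
    exact hI.restrictEquiv_symm_apply (φ ∘ₗ h) x

theorem BidualCondition.comap_isDualDense [IsNoetherianRing R] (H : BidualCondition R)
    {L : Type u} [AddCommGroup L] [Module R L] [Module.Finite R L] {I : Submodule R L}
    (hL : Function.Injective (bidualEval R L)) (hI : IsDualDense I)
    {L' : Type u} [AddCommGroup L'] [Module R L'] (g : L' →ₗ[R] L) :
    IsDualDense (I.comap g) := by
  have h := H (ModuleCat.of R I) inferInstance L' (hI.toBidual ∘ₗ g)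
  rw [Submodule.comap_comp] at h
  have h2 : (LinearMap.range (bidualEval R (ModuleCat.of R I))).comap hI.toBidual = I :=
    hI.comap_toBidual hL
  rwa [h2] at h

theorem BidualCondition.range_isDualDense (H : BidualCondition R)
    (C : Type u) [AddCommGroup C] [Module R C] [Module.Finite R C] :
    IsDualDense (LinearMap.range (bidualEval R C)) := by
  have h := H (ModuleCat.of R C) inferInstance _ LinearMap.id
  rwa [Submodule.comap_id] at h

/-- A functional on `C**` is determined by its restriction to the image of `C`, hence is evaluation
at an element of `C*`. -/
theorem BidualCondition.bidual_reflexive (H : BidualCondition R)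
    (C : Type u) [AddCommGroup C] [Module R C] [Module.Finite R C] :
    Function.Bijective (bidualEval R ((C →ₗ[R] R) →ₗ[Rᵐᵒᵖ] R)) := by
  let evDual : (C →ₗ[R] R) →ₗ[Rᵐᵒᵖ] (((C →ₗ[R] R) →ₗ[Rᵐᵒᵖ] R) →ₗ[R] R) :=
    { toFun := fun f =>
        { toFun := fun ψ => ψ f, map_add' := fun _ _ => rfl, map_smul' := fun _ _ => rfl }
      map_add' := fun f g => LinearMap.ext fun ψ => map_add ψ f g
      map_smul' := fun r f => LinearMap.ext fun ψ => map_smul ψ r f }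
  constructor
  · intro ψ ψ' h
    exact LinearMap.ext fun f => LinearMap.congr_fun h (evDual f)
  · intro Ψ
    refine ⟨Ψ ∘ₗ evDual, LinearMap.ext fun θ => ?_⟩
    have hθ : θ = evDual (θ ∘ₗ bidualEval R C) := (H.range_isDualDense C).1 (by
      refine LinearMap.ext ?_
      rintro ⟨_, c, rfl⟩
      rfl)
    conv_rhs => rw [hθ]
    conv_lhs => rw [hθ]
    rfl

end Dense

section Duality

variable (R) in
/-- The evaluation map of a right module. -/
def rightEval (N : Type v) [AddCommGroup N] [Module Rᵐᵒᵖ N] :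
    N →ₗ[Rᵐᵒᵖ] ((N →ₗ[Rᵐᵒᵖ] R) →ₗ[R] R) where
  toFun n :=
    { toFun := fun f => f n
      map_add' := fun _ _ => rfl
      map_smul' := fun _ _ => rfl }
  map_add' x y := LinearMap.ext fun f => map_add f x y
  map_smul' r x := LinearMap.ext fun f => map_smul f r x

/-- Reflexivity of a right module does not depend on whether the dual is formed with values in
`R` or in `Rᵐᵒᵖ`. -/
theorem bidualEval_op_bijective_iff (N : Type v) [AddCommGroup N] [Module Rᵐᵒᵖ N] :
    Function.Bijective (bidualEval Rᵐᵒᵖ N) ↔ Function.Bijective (rightEval R N) := by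
  let α : (N →ₗ[Rᵐᵒᵖ] R) ≃+ (N →ₗ[Rᵐᵒᵖ] Rᵐᵒᵖ) :=
    { toFun := fun f => (opRegularEquiv R).toLinearMap ∘ₗ f
      invFun := fun f => (opRegularEquiv R).symm.toLinearMap ∘ₗ f
      left_inv := fun f => rfl
      right_inv := fun f => rfl
      map_add' := fun _ _ => rfl }
  let β : ((N →ₗ[Rᵐᵒᵖ] R) →ₗ[R] R) ≃ ((N →ₗ[Rᵐᵒᵖ] Rᵐᵒᵖ) →ₗ[Rᵐᵒᵖᵐᵒᵖ] Rᵐᵒᵖ) :=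
    { toFun := fun ψ =>
        { toFun := fun φ => MulOpposite.op (ψ (α.symm φ))
          map_add' := fun φ φ' => by rw [map_add, map_add, MulOpposite.op_add]
          map_smul' := fun r φ =>
            congrArg MulOpposite.op (map_smul ψ r.unop.unop (α.symm φ)) }
      invFun := fun ψ =>
        { toFun := fun f => (ψ (α f)).unop
          map_add' := fun f f' => by rw [map_add, map_add, MulOpposite.unop_add]
          map_smul' := fun r f => congrArg MulOpposite.unop
            (map_smul ψ (MulOpposite.op (MulOpposite.op r)) (α f)) }
      left_inv := fun ψ => rfl
      right_inv := fun ψ => rfl }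
  have h : (bidualEval Rᵐᵒᵖ N : N → _) = β ∘ rightEval R N := rfl
  rw [h, Function.Bijective.of_comp_iff' β.bijective]

theorem rightEval_dual_bijective {M : Type v} [AddCommGroup M] [Module R M]
    (hM : Function.Bijective (bidualEval R M)) :
    Function.Bijective (rightEval R (M →ₗ[R] R)) := by
  constructor
  · intro f f' h
    exact LinearMap.ext fun m => LinearMap.congr_fun h (bidualEval R M m)
  · intro Ψ
    refine ⟨Ψ ∘ₗ bidualEval R M, LinearMap.ext fun ψ => ?_⟩
    obtain ⟨m, rfl⟩ := hM.2 ψ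
    rfl

theorem bidualEval_dual_bijective {N : Type v} [AddCommGroup N] [Module Rᵐᵒᵖ N]
    (hN : Function.Bijective (rightEval R N)) :
    Function.Bijective (bidualEval R (N →ₗ[Rᵐᵒᵖ] R)) := by
  constructor
  · intro f f' h
    exact LinearMap.ext fun m => LinearMap.congr_fun h (rightEval R N m)
  · intro Ψ
    refine ⟨Ψ ∘ₗ rightEval R N, LinearMap.ext fun ψ => ?_⟩
    obtain ⟨m, rfl⟩ := hN.2 ψ
    rfl

end Duality

end ReflexiveModules
/-! ### The category of reflexive modules -/

namespace ReflCat

variable {R : Type u} [Ring R]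

variable (R) in
/-- The object of `refl R` given by a finitely generated reflexive module. -/
abbrev of (M : Type u) [AddCommGroup M] [Module R M] [Module.Finite R M]
    (h : Function.Bijective (bidualEval R M)) : ReflCat R :=
  ⟨ModuleCat.of R M, ‹_›, h⟩

/-- The linear map underlying a morphism. -/
def lin {X Y : ReflCat R} (f : X ⟶ Y) : X.obj →ₗ[R] Y.obj := f.hom.hom

/-- The morphism given by a linear map. -/
def homOf {X Y : ReflCat R} (f : X.obj →ₗ[R] Y.obj) : X ⟶ Y :=
  ObjectProperty.homMk (ModuleCat.ofHom f)

@[simp] theorem lin_homOf {X Y : ReflCat R} (f : X.obj →ₗ[R] Y.obj) : lin (homOf f) = f := rfl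

@[simp] theorem homOf_lin {X Y : ReflCat R} (f : X ⟶ Y) : homOf (lin f) = f := rfl

theorem ext_lin {X Y : ReflCat R} {f g : X ⟶ Y} (h : lin f = lin g) : f = g := by
  rw [← homOf_lin f, h, homOf_lin]

instance finite (X : ReflCat R) : Module.Finite R X.obj := X.property.1

theorem reflexive (X : ReflCat R) : Function.Bijective (bidualEval R X.obj) := X.property.2

variable (R) in
/-- The regular module as an object of `refl R`. -/
abbrev regular : ReflCat R := of R R bidualEval_self_bijective

variable (R) in
/-- The free module of rank `k` as an object of `refl R`. -/
abbrev free (k : ℕ) : ReflCat R := of R (Fin k → R) (bidualEval_pi_bijective k)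

instance hasZeroObject : HasZeroObject (ReflCat R) := by
  refine ⟨free R 0, ?_⟩
  rw [IsZero.iff_id_eq_zero]
  exact ext_lin (LinearMap.ext fun x => funext fun i => i.elim0)

instance hasBinaryBiproducts : HasBinaryBiproducts (ReflCat R) where
  has_binary_biproduct X Y := hasBinaryBiproduct_of_total
    { pt := of R (X.obj × Y.obj) (bidualEval_prod_bijective X.reflexive Y.reflexive)
      fst := homOf (LinearMap.fst R X.obj Y.obj)
      snd := homOf (LinearMap.snd R X.obj Y.obj)
      inl := homOf (LinearMap.inl R X.obj Y.obj)
      inr := homOf (LinearMap.inr R X.obj Y.obj)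
      inl_fst := ext_lin (LinearMap.fst_comp_inl R X.obj Y.obj)
      inl_snd := ext_lin (LinearMap.snd_comp_inl R X.obj Y.obj)
      inr_fst := ext_lin (LinearMap.fst_comp_inr R X.obj Y.obj)
      inr_snd := ext_lin (LinearMap.snd_comp_inr R X.obj Y.obj) }
    (ext_lin (LinearMap.ext fun x => by
      change ((x.1, 0) : X.obj × Y.obj) + (0, x.2) = x
      simp))

instance hasFiniteProducts : HasFiniteProducts (ReflCat R) :=
  hasFiniteProducts_of_has_binary_and_terminal

theorem hasFiniteBiproducts : HasFiniteBiproducts (ReflCat R) :=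
  HasFiniteBiproducts.of_hasFiniteProducts

/-- A surjection onto a dual dense submodule, followed by a map to a reflexive module. -/
theorem exists_desc {N L W : Type*} [AddCommGroup N] [Module R N] [AddCommGroup L] [Module R L]
    [AddCommGroup W] [Module R W] {p : N →ₗ[R] L} (hp : IsDualDense (LinearMap.range p))
    (hW : Function.Bijective (bidualEval R W)) (h : N →ₗ[R] W)
    (hker : LinearMap.ker p ≤ LinearMap.ker h) : ∃ k : L →ₗ[R] W, k ∘ₗ p = h := by
  let h' : LinearMap.range p →ₗ[R] W :=
    (LinearMap.ker p).liftQ h hker ∘ₗ p.quotKerEquivRange.symm.toLinearMap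
  obtain ⟨k, hk⟩ := (hp.comp_subtype_bijective hW).2 h'
  refine ⟨k, LinearMap.ext fun x => ?_⟩
  have h1 : p.quotKerEquivRange.symm ⟨p x, x, rfl⟩ = Submodule.Quotient.mk x := by
    rw [LinearEquiv.symm_apply_eq]; rfl
  refine (LinearMap.congr_fun hk ⟨p x, x, rfl⟩).trans ?_
  change (LinearMap.ker p).liftQ h hker (p.quotKerEquivRange.symm ⟨p x, x, rfl⟩) = h x
  rw [h1]
  rfl

theorem epi_of_isDualDense {N L : ReflCat R} (p : N ⟶ L)
    (hp : IsDualDense (LinearMap.range (lin p))) : Epi p where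
  left_cancellation {W} f g h := by
    refine ext_lin ((hp.comp_subtype_bijective W.reflexive).1 (LinearMap.ext ?_))
    rintro ⟨_, x, rfl⟩
    exact LinearMap.congr_fun (congrArg lin h) x

/-- A morphism with dual dense image is the cokernel of any morphism onto its kernel. -/
theorem nonempty_isColimit_of_isDualDense {G N L : ReflCat R} (g : G ⟶ N) (p : N ⟶ L)
    (w : g ≫ p = 0) (hp : IsDualDense (LinearMap.range (lin p)))
    (hgp : ∀ {W : ReflCat R} (k : N ⟶ W), g ≫ k = 0 →
      LinearMap.ker (lin p) ≤ LinearMap.ker (lin k)) :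
    Nonempty (IsColimit (CokernelCofork.ofπ p w)) := by
  have := epi_of_isDualDense p hp
  refine ⟨CokernelCofork.IsColimit.ofπ' p w fun {W} k hk => ?_⟩
  have h := exists_desc hp W.reflexive (lin k) (hgp k hk)
  exact ⟨homOf h.choose, ext_lin h.choose_spec⟩

/-- The universal property tested against the single object `R`: uniqueness and existence of
factorizations are the two halves of dual density. -/
theorem isDualDense_of_isColimit {G N L : ReflCat R} (g : G ⟶ N) (p : N ⟶ L)
    (w : g ≫ p = 0) (hp : IsColimit (CokernelCofork.ofπ p w)) :
    IsDualDense (LinearMap.range (lin p)) := by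
  have hepi : Epi p := Cofork.IsColimit.epi hp
  constructor
  · intro φ φ' h
    have : p ≫ (homOf φ : L ⟶ regular R) = p ≫ homOf φ' := ext_lin (LinearMap.ext fun x =>
      LinearMap.congr_fun h ⟨lin p x, x, rfl⟩)
    exact congrArg lin ((cancel_epi p).1 this)
  · intro φ
    let k : N ⟶ regular R := homOf (φ ∘ₗ (lin p).rangeRestrict)
    have hk : g ≫ k = 0 := ext_lin (LinearMap.ext fun x => by
      have h0 : (lin p).rangeRestrict (lin g x) = 0 :=
        Subtype.ext (LinearMap.congr_fun (congrArg lin w) x)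
      change φ ((lin p).rangeRestrict (lin g x)) = 0
      rw [h0, map_zero])
    obtain ⟨l, hl⟩ := CokernelCofork.IsColimit.desc' hp k hk
    refine ⟨lin l, LinearMap.ext ?_⟩
    rintro ⟨_, x, rfl⟩
    exact LinearMap.congr_fun (congrArg lin hl) x

/-- The cokernels in `refl R` are the morphisms with dual dense image. -/
theorem cokernelMorphisms_iff [IsNoetherianRing R] {N L : ReflCat R} (p : N ⟶ L) :
    cokernelMorphisms (ReflCat R) p ↔ IsDualDense (LinearMap.range (lin p)) := by
  constructor
  · rintro ⟨h⟩
    exact isDualDense_of_isColimit h.g p h.w h.isColimit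
  · intro hp
    -- A finite free module covering the kernel serves as source, so the kernel itself need not be
    -- known to be reflexive.
    obtain ⟨k, q, hq⟩ := Module.Finite.exists_fin' R (LinearMap.ker (lin p))
    let g : free R k ⟶ N := homOf ((LinearMap.ker (lin p)).subtype ∘ₗ q)
    have w : g ≫ p = 0 := ext_lin (LinearMap.ext fun x => (q x).2)
    obtain ⟨hc⟩ := nonempty_isColimit_of_isDualDense g p w hp fun {W} l hl x hx => by
      obtain ⟨y, hy⟩ := hq ⟨x, hx⟩
      have h1 : lin l ((LinearMap.ker (lin p)).subtype (q y)) = 0 :=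
        LinearMap.congr_fun (congrArg lin hl) y
      rw [hy] at h1
      exact h1
    exact ⟨⟨free R k, g, w, hc⟩⟩

/-- Elements are morphisms from `R`, which is an object of `refl R`, so the pull-back has the
elements of the module pull-back. -/
theorem range_of_isPullback {P N L' L : ReflCat R} {f' : P ⟶ N} {p' : P ⟶ L'} {p : N ⟶ L}
    {g : L' ⟶ L} (sq : IsPullback f' p' p g) :
    LinearMap.range (lin p') = (LinearMap.range (lin p)).comap (lin g) := by
  ext y
  constructor
  · rintro ⟨x, rfl⟩
    exact ⟨lin f' x, LinearMap.congr_fun (congrArg lin sq.w) x⟩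
  · rintro ⟨x, hx⟩
    let a : regular R ⟶ N := homOf (LinearMap.toSpanSingleton R N.obj x)
    let b : regular R ⟶ L' := homOf (LinearMap.toSpanSingleton R L'.obj y)
    have hab : a ≫ p = b ≫ g := ext_lin (LinearMap.ext_ring (by
      change lin p ((1 : R) • x) = lin g ((1 : R) • y)
      rw [one_smul, one_smul, hx]))
    refine ⟨lin (sq.lift a b hab) (1 : R), ?_⟩
    have h1 := LinearMap.congr_fun (congrArg lin (sq.lift_snd a b hab)) (1 : R)
    refine h1.trans ?_
    change (1 : R) • y = y
    rw [one_smul]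

theorem isStableUnderBaseChange_of_bidualCondition [IsNoetherianRing R]
    (H : BidualCondition R) : (cokernelMorphisms (ReflCat R)).IsStableUnderBaseChange where
  of_isPullback {X Y Y' S f g f' g'} sq hg := by
    rw [cokernelMorphisms_iff] at hg ⊢
    rw [range_of_isPullback sq]
    exact H.comap_isDualDense S.reflexive.1 hg (lin f)

/-- The cokernel is the bidual of the module cokernel `C`; the image of `C` in it is dual dense. -/
theorem hasCokernels_of_bidualCondition [IsNoetherianRing R] [IsNoetherianRing Rᵐᵒᵖ]
    (H : BidualCondition R) : HasCokernels (ReflCat R) where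
  has_colimit {M N} f := by
    let C := N.obj ⧸ LinearMap.range (lin f)
    have := finite_dual_left (R := R) C
    have := finite_dual_right (R := R) (C →ₗ[R] R)
    let L : ReflCat R := of R ((C →ₗ[R] R) →ₗ[Rᵐᵒᵖ] R) (H.bidual_reflexive C)
    let p : N ⟶ L := homOf (bidualEval R C ∘ₗ (LinearMap.range (lin f)).mkQ)
    have w : f ≫ p = 0 := ext_lin (LinearMap.ext fun x => by
      have h0 : (LinearMap.range (lin f)).mkQ (lin f x) = 0 :=
        (Submodule.Quotient.mk_eq_zero _).2 ⟨x, rfl⟩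
      change bidualEval R C ((LinearMap.range (lin f)).mkQ (lin f x)) = 0
      rw [h0, map_zero])
    have hrange : LinearMap.range (lin p) = LinearMap.range (bidualEval R C) :=
      LinearMap.range_comp_of_range_eq_top _ (Submodule.range_mkQ _)
    have hp : IsDualDense (LinearMap.range (lin p)) := by
      rw [hrange]
      exact H.range_isDualDense C
    obtain ⟨hc⟩ := nonempty_isColimit_of_isDualDense f p w hp fun {W} k hk x hx => by
      have hk' : LinearMap.range (lin f) ≤ LinearMap.ker (lin k) := by
        rintro _ ⟨y, rfl⟩
        exact LinearMap.congr_fun (congrArg lin hk) y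
      refine eq_of_forall_dual_eq W.reflexive.1 fun φ => ?_
      rw [map_zero]
      exact LinearMap.congr_fun hx (φ ∘ₗ (LinearMap.range (lin f)).liftQ (lin k) hk')
    exact ⟨⟨⟨_, hc⟩⟩⟩

/-- If `refl R` has kernels and cokernels and its cokernels are stable under pull-back, then `R`
satisfies the strong grade condition. -/
theorem strongGradeCondition_of_isStable [IsNoetherianRing R] [IsNoetherianRing Rᵐᵒᵖ]
    [HasKernels (ReflCat R)] [HasCokernels (ReflCat R)]
    (H : (cokernelMorphisms (ReflCat R)).IsStableUnderBaseChange) :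
    StrongGradeCondition R 2 2 := by
  refine strongGradeCondition_of_isDualDense fun M hM k g => ?_
  obtain ⟨n, π, hπ⟩ := Module.Finite.exists_fin' R M
  obtain ⟨m, y, hy⟩ := Module.Finite.exists_fin' R (LinearMap.ker π)
  -- The cokernel `L` in `refl R` of a presentation of `M` turns out to be `M**`, with the induced
  -- map `q : M → L` as evaluation map.
  let a : free R m ⟶ free R n := homOf ((LinearMap.ker π).subtype ∘ₗ y)
  let L := cokernel a
  let c : free R n ⟶ L := cokernel.π a
  have hc : cokernelMorphisms (ReflCat R) c :=
    ⟨⟨free R m, a, cokernel.condition a, cokernelIsCokernel a⟩⟩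
  have hker : ∀ {W : ReflCat R} (k : free R n ⟶ W),
      a ≫ k = 0 ↔ LinearMap.ker π ≤ LinearMap.ker (lin k) := by
    intro W k
    constructor
    · intro hk x hx
      obtain ⟨z, hz⟩ := hy ⟨x, hx⟩
      have h1 : lin k ((LinearMap.ker π).subtype (y z)) = 0 :=
        LinearMap.congr_fun (congrArg lin hk) z
      rw [hz] at h1
      exact h1
    · intro hk
      exact ext_lin (LinearMap.ext fun z => hk (y z).2)
  let q : M →ₗ[R] L.obj := (LinearMap.ker π).liftQ (lin c) ((hker c).1 (cokernel.condition a)) ∘ₗ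
    (π.quotKerEquivOfSurjective hπ).symm.toLinearMap
  have hqπ : ∀ x, q (π x) = lin c x := fun x => by
    have h1 : (π.quotKerEquivOfSurjective hπ).symm (π x) = Submodule.Quotient.mk x := by
      rw [LinearEquiv.symm_apply_eq]; rfl
    change (LinearMap.ker π).liftQ (lin c) ((hker c).1 (cokernel.condition a))
      ((π.quotKerEquivOfSurjective hπ).symm (π x)) = _
    rw [h1]
    rfl
  have hrange : LinearMap.range q = LinearMap.range (lin c) := by
    ext z
    constructor
    · rintro ⟨x, rfl⟩
      obtain ⟨x, rfl⟩ := hπ x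
      exact ⟨x, (hqπ x).symm⟩
    · rintro ⟨x, rfl⟩
      exact ⟨π x, hqπ x⟩
  let r : (L.obj →ₗ[R] R) →ₗ[Rᵐᵒᵖ] (M →ₗ[R] R) :=
    { toFun := fun φ => φ ∘ₗ q, map_add' := fun _ _ => rfl, map_smul' := fun _ _ => rfl }
  -- By the universal property tested against `R`, composition with `q` identifies `L*` with `M*`;
  -- reflexivity of `L` then gives `L ≅ M**`.
  have hr : Function.Bijective r := by
    constructor
    · intro φ φ' h
      have : c ≫ (homOf φ : L ⟶ regular R) = c ≫ homOf φ' := ext_lin (LinearMap.ext fun x => by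
        change φ (lin c x) = φ' (lin c x)
        rw [← hqπ]
        exact LinearMap.congr_fun h (π x))
      exact congrArg lin ((cancel_epi c).1 this)
    · intro f
      have h0 : a ≫ (homOf (f ∘ₗ π) : free R n ⟶ regular R) = 0 :=
        (hker _).2 (LinearMap.ker_le_ker_comp π f)
      refine ⟨lin (cokernel.desc a _ h0), LinearMap.ext fun x => ?_⟩
      obtain ⟨x, rfl⟩ := hπ x
      change lin (cokernel.desc a _ h0) (q (π x)) = f (π x)
      rw [hqπ]
      exact LinearMap.congr_fun (congrArg lin (cokernel.π_desc a _ h0)) x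
  let ρ := LinearEquiv.ofBijective r hr
  let θ₀ : L.obj →ₗ[R] ((M →ₗ[R] R) →ₗ[Rᵐᵒᵖ] R) :=
    { toFun := fun l => bidualEval R L.obj l ∘ₗ ρ.symm.toLinearMap
      map_add' := fun x y => by rw [map_add, LinearMap.add_comp]
      map_smul' := fun s x => by rw [map_smul, LinearMap.smul_comp, RingHom.id_apply] }
  have hθ₀ : Function.Bijective θ₀ := by
    constructor
    · intro x x' h
      refine eq_of_forall_dual_eq L.reflexive.1 fun φ => ?_
      have h1 : bidualEval R L.obj x (ρ.symm (ρ φ)) = bidualEval R L.obj x' (ρ.symm (ρ φ)) :=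
        LinearMap.congr_fun h (ρ φ)
      rw [LinearEquiv.symm_apply_apply] at h1
      exact h1
    · intro ψ
      obtain ⟨l, hl⟩ := L.reflexive.2 (ψ ∘ₗ ρ.toLinearMap)
      refine ⟨l, LinearMap.ext fun f => ?_⟩
      refine (LinearMap.congr_fun hl (ρ.symm f)).trans ?_
      exact congrArg ψ (ρ.apply_symm_apply f)
  have hθq : ∀ x, θ₀ (q x) = bidualEval R M x := fun x => LinearMap.ext fun f =>
    LinearMap.congr_fun (ρ.apply_symm_apply f) x
  let θ := LinearEquiv.ofBijective θ₀ hθ₀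
  let g' : free R k ⟶ L := homOf (θ.symm.toLinearMap ∘ₗ g)
  have : HasEqualizers (ReflCat R) := Preadditive.hasEqualizers_of_hasKernels
  have : HasPullbacks (ReflCat R) := hasPullbacks_of_hasBinaryProducts_of_hasEqualizers _
  -- Pulling `c` back along `g` yields a cokernel whose image is the preimage of the image of `M`,
  -- so that preimage is dual dense.
  have sq := IsPullback.of_hasPullback c g'
  have hsnd := (cokernelMorphisms_iff _).1 (H.of_isPullback sq hc)
  rw [range_of_isPullback sq, ← hrange] at hsnd
  convert hsnd using 1
  ext x
  constructor
  · rintro ⟨z, hz⟩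
    refine ⟨z, ?_⟩
    change q z = θ.symm (g x)
    rw [LinearEquiv.eq_symm_apply, ← hz]
    exact hθq z
  · rintro ⟨z, hz⟩
    refine ⟨z, ?_⟩
    have hz' : q z = θ.symm (g x) := hz
    rw [LinearEquiv.eq_symm_apply] at hz'
    rw [← hθq]
    exact hz'

end ReflCat
/-! ### Duality -/

section Opposite

variable {C : Type*} [Category.{v} C] [Preadditive C]
  {D : Type*} [Category.{v} D] [Preadditive D]

/-- A morphism is a kernel if its opposite is a cokernel. -/
theorem nonempty_normalMono_of_op {X Y : C} (f : X ⟶ Y) (h : NormalEpi f.op) :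
    Nonempty (NormalMono f) := by
  have hw : f ≫ h.g.unop = 0 := Quiver.Hom.op_inj h.w
  have : Epi f.op := Cofork.IsColimit.epi h.isColimit
  have : Mono f := unop_mono_of_epi f.op
  refine ⟨⟨h.W.unop, h.g.unop, hw, KernelFork.IsLimit.ofι' f hw fun {A} k hk => ?_⟩⟩
  have hl := CokernelCofork.IsColimit.desc' h.isColimit k.op (Quiver.Hom.unop_inj hk)
  exact ⟨hl.1.unop, Quiver.Hom.op_inj hl.2⟩

theorem cokernelMorphisms_op : cokernelMorphisms Cᵒᵖ = (kernelMorphisms C).op := by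
  ext X Y f
  exact ⟨fun ⟨h⟩ => nonempty_normalMono_of_op f.unop h,
    fun ⟨h⟩ => ⟨normalEpiOfNormalMonoUnop f h⟩⟩

theorem isStableUnderCobaseChange_iff_op :
    (kernelMorphisms C).IsStableUnderCobaseChange ↔
      (cokernelMorphisms Cᵒᵖ).IsStableUnderBaseChange := by
  rw [cokernelMorphisms_op]
  constructor
  · intro h
    infer_instance
  · intro h
    exact inferInstanceAs ((kernelMorphisms C).op.unop).IsStableUnderCobaseChange

theorem cokernelMorphisms_map_iff (F : C ⥤ D) [F.IsEquivalence] {X Y : C} (f : X ⟶ Y) :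
    cokernelMorphisms D (F.map f) ↔ cokernelMorphisms C f := by
  constructor
  · rintro ⟨h⟩
    exact ⟨equivalenceReflectsNormalEpi F h⟩
  · rintro ⟨h⟩
    refine ⟨equivalenceReflectsNormalEpi F.asEquivalence.inverse (h.ofArrowIso ?_)⟩
    exact Arrow.isoMk (F.asEquivalence.unitIso.app X) (F.asEquivalence.unitIso.app Y)
      (F.asEquivalence.unitIso.hom.naturality f).symm

theorem isStableUnderBaseChange_of_equivalence (F : C ⥤ D) [F.IsEquivalence]
    (h : (cokernelMorphisms D).IsStableUnderBaseChange) :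
    (cokernelMorphisms C).IsStableUnderBaseChange where
  of_isPullback sq hg := (cokernelMorphisms_map_iff F _).1
    (h.of_isPullback (sq.map F) ((cokernelMorphisms_map_iff F _).2 hg))

theorem hasKernels_of_equivalence_op (F : C ⥤ Dᵒᵖ) [F.IsEquivalence] [HasCokernels D] :
    HasKernels C := by
  have : HasCoequalizers D := Preadditive.hasCoequalizers_of_hasCokernels
  have : HasEqualizers C := Adjunction.hasLimitsOfShape_of_equivalence F
  infer_instance

theorem hasCokernels_of_equivalence_op (F : C ⥤ Dᵒᵖ) [F.IsEquivalence] [HasKernels D] :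
    HasCokernels C := by
  have : HasEqualizers D := Preadditive.hasEqualizers_of_hasKernels
  have : HasCoequalizers C := Adjunction.hasColimitsOfShape_of_equivalence F
  infer_instance

end Opposite

/-! ### The duality between `refl R` and `refl Rᵐᵒᵖ`. -/

namespace ReflCat

variable (R : Type u) [Ring R]

section Functor

variable [IsNoetherianRing Rᵐᵒᵖ]

/-- The dual of a reflexive module, as a reflexive right module. -/
def dual (M : ReflCat R) : ReflCat Rᵐᵒᵖ :=
  have := finite_dual_left (R := R) M.obj
  of Rᵐᵒᵖ (M.obj →ₗ[R] R)
    ((bidualEval_op_bijective_iff _).2 (rightEval_dual_bijective M.reflexive))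

/-- The transpose of a map of reflexive modules. -/
def dualMap {M N : ReflCat R} (f : M ⟶ N) : dual R N ⟶ dual R M :=
  homOf (X := dual R N) (Y := dual R M)
    { toFun := fun φ : N.obj →ₗ[R] R => φ ∘ₗ lin f
      map_add' := fun _ _ => rfl
      map_smul' := fun _ _ => rfl }

/-- The duality functor. -/
def dualFunctor : ReflCat R ⥤ (ReflCat Rᵐᵒᵖ)ᵒᵖ where
  obj M := Opposite.op (dual R M)
  map f := (dualMap R f).op
  map_id _ := rfl
  map_comp _ _ := rfl

instance : (dualFunctor R).Faithful where
  map_injective {M N f g} h := by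
    refine ext_lin (LinearMap.ext fun x => eq_of_forall_dual_eq N.reflexive.1 fun φ => ?_)
    have h1 : dualMap R f = dualMap R g := Quiver.Hom.op_inj h
    have h2 : φ ∘ₗ lin f = φ ∘ₗ lin g :=
      LinearMap.congr_fun (congrArg lin h1) (show (dual R N).obj from φ)
    exact LinearMap.congr_fun h2 x

instance : (dualFunctor R).Full where
  map_surjective {M N} u := by
    let u' : (N.obj →ₗ[R] R) →ₗ[Rᵐᵒᵖ] (M.obj →ₗ[R] R) :=
      lin (X := dual R N) (Y := dual R M) u.unop
    let evN := LinearEquiv.ofBijective (bidualEval R N.obj) N.reflexive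
    let pre : M.obj →ₗ[R] ((N.obj →ₗ[R] R) →ₗ[Rᵐᵒᵖ] R) :=
      { toFun := fun m => bidualEval R M.obj m ∘ₗ u'
        map_add' := fun x y => by rw [map_add, LinearMap.add_comp]
        map_smul' := fun s x => by rw [map_smul, LinearMap.smul_comp, RingHom.id_apply] }
    refine ⟨homOf (evN.symm.toLinearMap ∘ₗ pre), Quiver.Hom.unop_inj ?_⟩
    refine ext_lin (LinearMap.ext fun φ : N.obj →ₗ[R] R => ?_)
    change φ ∘ₗ (evN.symm.toLinearMap ∘ₗ pre) = u' φ
    refine LinearMap.ext fun x => ?_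
    exact LinearMap.congr_fun (evN.apply_symm_apply (pre x)) φ

instance [IsNoetherianRing R] : (dualFunctor R).EssSurj where
  mem_essImage N := by
    let N' := N.unop
    have hN := (bidualEval_op_bijective_iff (R := R) N'.obj).1 N'.reflexive
    have := finite_dual_right (R := R) N'.obj
    let M : ReflCat R := of R (N'.obj →ₗ[Rᵐᵒᵖ] R) (bidualEval_dual_bijective hN)
    let e : N'.obj ≃ₗ[Rᵐᵒᵖ] (dual R M).obj := LinearEquiv.ofBijective (rightEval R N'.obj) hN
    exact ⟨M, ⟨(ObjectProperty.isoMk _ e.toModuleIso : N' ≅ dual R M).op⟩⟩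

instance [IsNoetherianRing R] : (dualFunctor R).IsEquivalence where

end Functor

variable [IsNoetherianRing R] [IsNoetherianRing Rᵐᵒᵖ]

/-- The contravariant equivalence `M ↦ M*` exchanges kernels with cokernels and push-outs with
pull-backs. -/
theorem isStableUnderCobaseChange_iff :
    (kernelMorphisms (ReflCat R)).IsStableUnderCobaseChange ↔
      (cokernelMorphisms (ReflCat Rᵐᵒᵖ)).IsStableUnderBaseChange := by
  rw [isStableUnderCobaseChange_iff_op]
  exact ⟨isStableUnderBaseChange_of_equivalence (dualFunctor R).leftOp.asEquivalence.inverse,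
    isStableUnderBaseChange_of_equivalence (dualFunctor R).leftOp⟩

/-- `refl R` is quasi-abelian if and only if both strong grade conditions hold. -/
theorem isQuasiAbelian_iff [IsNoetherianRing Rᵐᵒᵖᵐᵒᵖ] : IsQuasiAbelian (ReflCat R) ↔
    StrongGradeCondition R 2 2 ∧ StrongGradeCondition Rᵐᵒᵖ 2 2 := by
  let G : ReflCat Rᵐᵒᵖ ⥤ (ReflCat R)ᵒᵖ := (dualFunctor R).leftOp.asEquivalence.inverse
  constructor
  · intro h
    have := h.hasKernels
    have := h.hasCokernels
    -- Kernels and cokernels of `refl Rᵐᵒᵖ` are the duals of cokernels and kernels of `refl R`, so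
    -- the one-sided criterion applies over `Rᵐᵒᵖ` too.
    have := hasKernels_of_equivalence_op G
    have := hasCokernels_of_equivalence_op G
    exact ⟨strongGradeCondition_of_isStable h.cokernels_pullback,
      strongGradeCondition_of_isStable ((isStableUnderCobaseChange_iff R).1 h.kernels_pushout)⟩
  · rintro ⟨h, h'⟩
    have hb := bidualCondition_of_strongGradeCondition h
    have hb' := bidualCondition_of_strongGradeCondition h'
    have := hasCokernels_of_bidualCondition hb'
    exact
      { hasFiniteBiproducts := hasFiniteBiproducts
        hasKernels := hasKernels_of_equivalence_op (dualFunctor R)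
        hasCokernels := hasCokernels_of_bidualCondition hb
        kernels_pushout := (isStableUnderCobaseChange_iff R).2
          (isStableUnderBaseChange_of_bidualCondition hb')
        cokernels_pullback := isStableUnderBaseChange_of_bidualCondition hb }

end ReflCat

theorem mainTheorem1 (R : Type u) [Ring R] [IsNoetherianRing R] [IsNoetherianRing Rᵐᵒᵖ] :
    (IsQuasiAbelian (ReflCat R) ↔ TwoSidedAuslanderCondition R 2 2) ∧
    (AuslanderCondition R 2 2 ↔ StrongGradeCondition R 2 2) ∧
    (AuslanderCondition Rᵐᵒᵖ 2 2 ↔ StrongGradeCondition Rᵐᵒᵖ 2 2) := by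
  -- The results over `Rᵐᵒᵖ` ask for its opposite to be Noetherian, and that opposite is `R` up to
  -- isomorphism.
  have : IsNoetherianRing Rᵐᵒᵖᵐᵒᵖ := isNoetherianRing_of_ringEquiv R (RingEquiv.opOp R)
  refine ⟨?_, auslanderCondition_iff_strongGradeCondition R,
    auslanderCondition_iff_strongGradeCondition Rᵐᵒᵖ⟩
  rw [ReflCat.isQuasiAbelian_iff, TwoSidedAuslanderCondition,
    auslanderCondition_iff_strongGradeCondition R, auslanderCondition_iff_strongGradeCondition Rᵐᵒᵖ]
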